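/- **Setting.** Let $G=(V,E)$ be a finite simple bipartite graph with colour classes $F$ (firms) and $W$ (workers), capacities $b(e)>0$ ($e\in E$), quotas $q(v)>0$ ($v\in V$), and for each $v\in V$ a weak linear order $\ge_v$ (transitive and total) on the set $E_v$ of edges incident to $v$; its classes of equivalent edges are called ties, ordered from best to worst as $\pi^1>_v\pi^2>_v\cdots>_v\pi^k$. Let $\mathcal B=\{x\in\mathbb R_+^E: x\le b\}$, let $\mathcal B_v$ be the set of restrictions $x_v$ of $x\in\mathcal B$ to $E_v$, and write $z(A)=\sum_{e\in A}z(e)$ and $|z|=z(E_v)$ for $z\in\mathcal B_v$. The choice function $C_v:\mathcal B_v\to\mathcal B_v$ is: $C_v(z)=z$ if $|z|\le q(v)$; otherwise let $\pi^i$ be the *critical tie*, given by $z(\pi^1\cup\dots\cup\pi^{i-1})<q(v)\le z(\pi^1\cup\dots\cup\pi^i)$, and let $C_v(z)$ equal $z$ on better ties, $0$ on worse ties, and $\min(r,z(e))$ for $e\in\pi^i$, with $r$ chosen so that $|C_v(z)|=q(v)$. An $x\in\mathcal B$ with $C_v(x_v)=x_v$ for all $v$ is *stable* if no edge $fw$ is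 interesting under $x$ for both $f$ and $w$; here $e\in E_v$ is *interesting* for $v$ if there is $z'\in\mathcal B_v$ with $z'(e)>x(e)$, $z'=x_v$ on $E_v\setminus\{e\}$, and $C_v(z')(e)>x(e)$. For stable $x,y$ write $x\succeq_W y$ if $C_w(x_w\vee y_w)=x_w$ for all $w\in W$. Let $x^{\max}$ denote the greatest stable assignment with respect to $\succeq_W$. Fix a stable $x$. A vertex $v$ is *fully filled* if $|x_v|=q(v)$ and *deficit* if $|x_v|<q(v)$. For fully filled $v$, the *head* $H_v$ is the set of edges of the critical tie of $x_v$ on which $x$ attains its maximum over that tie, and the *tail* $T_v$ consists of the remaining edges of the critical tie and all edges of better ties; for deficit $v$, $H_v=\emptyset$ and $T_v=E_v$. An edge $e$ is *unsaturated* if $x(e)<b(e)$. For a fully filled firm $f$, consider the ties $\pi$ at $f$ such that (a) the set of unsaturated edges $fw\in\pi$ with $fw\in T_w$ is nonempty, and (b) no tie at $f$ better than or equal to $\pi$ contains an unsaturated edge incident to a deficit worker; let $D_f$ be the set in (a) for the best such tie, and $D_f=\emptyset$ if there is none. The *singular* vertices form the smallest set $V^0$ of fully filled vertices that contains every fully filled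 $w\in W$ for which $H_w$ has an edge incident to a deficit firm, every fully filled $f\in F$ with $D_f=\emptyset$, and every fully filled vertex $v$ for which $D_v$ (if $v\in F$), respectively $H_v$ (if $v\in W$), has an edge whose other end is in $V^0$. Let $F^+$ and $W^+$ be the sets of fully filled non-singular firms and workers. The *active edges* are the edges of the sets $D_f$ ($f\in F^+$) and $H_w$ ($w\in W^+$). The directed *active graph* $\vec\Gamma(x)$ has an arc $(f,w)$ for each $fw\in D_f$, $f\in F^+$, and an arc $(w,f)$ for each $fw\in H_w$, $w\in W^+$. A *strong component* is a maximal strongly connected subgraph with more than one vertex. **Statement.** For every stable $x$ the following are equivalent: (i) $x\ne x^{\max}$; (ii) for some $\varepsilon>0$ there are $\phi\in\mathbb R^{F^+}$, $\psi\in\mathbb R^{W^+}$ with $$|D_f|\,\phi_f-\sum_{w\in W^+:\ fw\in H_w}\psi_w=0\quad(f\in F^+),$$ $$|H_w|\,\psi_w-\sum_{f\in F^+:\ fw\in D_f}\phi_f=0\quad(w\in W^+),$$ $$\sum_{f\in F^+}|D_f|\phi_f+\sum_{w\in W^+}|H_w|\psi_w=\varepsilon,\qquad \phi\ge0,\ \psi\ge0;$$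 (iii) the set of active edges is nonempty; (iv) the directed active graph $\vec\Gamma(x)$ has a strong component. -/

import Mathlib

/-- The vertex `v` (a firm `Sum.inl f` or a worker `Sum.inr w`) is an end of the edge `p = fw`. -/
def IsEnd {F W : Type*} (v : F ⊕ W) (p : F × W) : Prop :=
  v = Sum.inl p.1 ∨ v = Sum.inr p.2

/-- An instance of the stability problem SMP: a (simple) bipartite graph with colour classes
`F` (firms) and `W` (workers), positive capacities on the edges, positive quotas on the vertices,
and for every vertex `v` a weak linear order `ge v` on the set `E_v` of edges incident to `v`
(values of `ge v` outside `E_v` play no role). -/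
structure SMP (F W : Type*) where
  E : Finset (F × W)
  b : E → ℝ
  b_pos : ∀ e, 0 < b e
  q : F ⊕ W → ℝ
  q_pos : ∀ v, 0 < q v
  ge : F ⊕ W → E → E → Prop
  ge_total : ∀ v (e e' : E), IsEnd v e.1 → IsEnd v e'.1 → ge v e e' ∨ ge v e' e
  ge_trans : ∀ v (e e' e'' : E), IsEnd v e.1 → IsEnd v e'.1 → IsEnd v e''.1 →
    ge v e e' → ge v e' e'' → ge v e e''

namespace SMP

variable {F W : Type*} (I : SMP F W)

/-- The firm at the edge `e`, as a vertex. -/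
def firm (e : I.E) : F ⊕ W := Sum.inl e.1.1

/-- The worker at the edge `e`, as a vertex. -/
def worker (e : I.E) : F ⊕ W := Sum.inr e.1.2

open Classical in
/-- `E_v`: the set of edges incident to `v`. -/
noncomputable def star (v : F ⊕ W) : Finset I.E :=
  Finset.univ.filter fun e => IsEnd v e.1

/-- `e >_v e'`. -/
def gt (v : F ⊕ W) (e e' : I.E) : Prop := I.ge v e e' ∧ ¬ I.ge v e' e

/-- `|z_v|`, the total of `z` on `E_v` (for nonnegative `z`). -/
noncomputable def load (v : F ⊕ W) (z : I.E → ℝ) : ℝ := ∑ e ∈ I.star v, z e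

open Classical in
/-- The edges of `E_v` lying in the ties strictly better than the tie of `e`. -/
noncomputable def before (v : F ⊕ W) (e : I.E) : Finset I.E :=
  (I.star v).filter fun e' => I.gt v e' e

open Classical in
/-- The edges of `E_v` lying in the tie of `e` or in better ties. -/
noncomputable def upTo (v : F ⊕ W) (e : I.E) : Finset I.E :=
  (I.star v).filter fun e' => I.ge v e' e

open Classical in
/-- The critical tie of `z` at `v`: the tie `π^i` with
`z(π^1 ∪ … ∪ π^{i-1}) < q(v) ≤ z(π^1 ∪ … ∪ π^i)` (empty if there is none). -/
noncomputable def critical (v : F ⊕ W) (z : I.E → ℝ) : Finset I.E :=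
  (I.star v).filter fun e => ∑ a ∈ I.before v e, z a < I.q v ∧ I.q v ≤ ∑ a ∈ I.upTo v e, z a

open Classical in
/-- The edges in the ties better than the critical tie. -/
noncomputable def beg (v : F ⊕ W) (z : I.E → ℝ) : Finset I.E :=
  (I.star v).filter fun e => ∃ c ∈ I.critical v z, I.gt v e c

/-- The cutting height in the critical tie. The defining equation determines it uniquely, except
when the edges up to the critical tie carry exactly `q(v)`; then every `r` from the maximum of `z`
on the critical tie upwards satisfies it, and the least solution, that maximum, is taken. -/
noncomputable def cut (v : F ⊕ W) (z : I.E → ℝ) : ℝ :=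
  sInf {r : ℝ | ∑ e ∈ I.beg v z, z e + ∑ e ∈ I.critical v z, min r (z e) = I.q v}

open Classical in
/-- The mixed choice function `C_v`. It depends only on the restriction of `z` to `E_v`, and only
its values on `E_v` are meaningful. -/
noncomputable def choice (v : F ⊕ W) (z : I.E → ℝ) (e : I.E) : ℝ :=
  if I.load v z ≤ I.q v then z e
  else if e ∈ I.beg v z then z e
  else if e ∈ I.critical v z then min (I.cut v z) (z e)
  else 0

/-- The box of admissible assignments `0 ≤ x ≤ b`. -/
def Admissible (x : I.E → ℝ) : Prop := ∀ e, 0 ≤ x e ∧ x e ≤ I.b e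

/-- Fully stationary assignments: admissible with `C_v(x_v) = x_v` for all vertices `v`. -/
def FullyStationary (x : I.E → ℝ) : Prop :=
  I.Admissible x ∧ ∀ v, ∀ e ∈ I.star v, I.choice v x e = x e

/-- The edge `e ∈ E_v` is interesting for `v` under `x_v`. -/
def Interesting (v : F ⊕ W) (x : I.E → ℝ) (e : I.E) : Prop :=
  e ∈ I.star v ∧ ∃ z : I.E → ℝ, I.Admissible z ∧ x e < z e ∧
    (∀ e' ∈ I.star v, e' ≠ e → z e' = x e') ∧ x e < I.choice v z e

/-- The edge `e` is blocking for `x`. -/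
def Blocking (x : I.E → ℝ) (e : I.E) : Prop :=
  I.Interesting (I.firm e) x e ∧ I.Interesting (I.worker e) x e

/-- Stable assignments. -/
def Stable (x : I.E → ℝ) : Prop := I.FullyStationary x ∧ ∀ e, ¬ I.Blocking x e

/-- Revealed preference at `v`: `x_v ⪰_v y_v`, i.e. `C_v(x_v ∨ y_v) = x_v`. -/
def Prefers (v : F ⊕ W) (x y : I.E → ℝ) : Prop :=
  ∀ e ∈ I.star v, I.choice v (x ⊔ y) e = x e

/-- `x ⪰_W y`: every worker weakly prefers `x` to `y`. -/
def PrefersW (x y : I.E → ℝ) : Prop := ∀ w : W, I.Prefers (Sum.inr w) x y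

/-- `x` is `x^max`, the greatest element of the set of stable assignments ordered by `⪰_W`. -/
def IsXMax (x : I.E → ℝ) : Prop := I.Stable x ∧ ∀ y, I.Stable y → I.PrefersW x y

/-- `v` is fully filled by `x`. -/
def FullyFilled (x : I.E → ℝ) (v : F ⊕ W) : Prop := I.load v x = I.q v

/-- `v` is deficit for `x`. -/
def Deficit (x : I.E → ℝ) (v : F ⊕ W) : Prop := I.load v x < I.q v

open Classical in
/-- The head `H_v(x)`. -/
noncomputable def head (x : I.E → ℝ) (v : F ⊕ W) : Finset I.E :=
  if I.FullyFilled x v then (I.critical v x).filter fun e => x e = I.cut v x else ∅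

open Classical in
/-- The tail `T_v(x)`. -/
noncomputable def tail (x : I.E → ℝ) (v : F ⊕ W) : Finset I.E :=
  if I.FullyFilled x v then I.beg v x ∪ (I.critical v x \ I.head x v) else I.star v

/-- The edge `e` is unsaturated by `x`. -/
def Unsaturated (x : I.E → ℝ) (e : I.E) : Prop := x e < I.b e

open Classical in
/-- For `e ∈ E_f` in the tie `π^i`: the set `D^i_f(x)` of the unsaturated edges `fw ∈ π^i` that
belong to `T_w(x)`. -/
noncomputable def tieD (x : I.E → ℝ) (f : F) (e : I.E) : Finset I.E :=
  (I.star (Sum.inl f)).filter fun a =>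
    (I.ge (Sum.inl f) a e ∧ I.ge (Sum.inl f) e a) ∧ I.Unsaturated x a ∧ a ∈ I.tail x (I.worker a)

/-- The tie of `e ∈ E_f` belongs to `\hat Π_f(x)`: its set `D^i_f(x)` is nonempty, and no tie
better than or equal to it contains an unsaturated edge incident to a deficit worker. -/
def Candidate (x : I.E → ℝ) (f : F) (e : I.E) : Prop :=
  e ∈ I.star (Sum.inl f) ∧ (I.tieD x f e).Nonempty ∧
    ¬ ∃ a ∈ I.star (Sum.inl f), I.ge (Sum.inl f) a e ∧ I.Unsaturated x a ∧
      I.Deficit x (I.worker a)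

open Classical in
/-- The potential head `D_f(x)`: the set `D^i_f(x)` of the best tie in `\hat Π_f(x)`, and the empty
set if `\hat Π_f(x)` is empty. -/
noncomputable def potentialHead (x : I.E → ℝ) (f : F) : Finset I.E :=
  (I.star (Sum.inl f)).filter fun a =>
    I.Candidate x f a ∧ (∀ c, I.Candidate x f c → I.ge (Sum.inl f) a c) ∧ a ∈ I.tieD x f a

/-- The set that matters for a local change of `x` at `v`: `D_f(x)` for a firm `f`, `H_w(x)` for a
worker `w`. -/
noncomputable def outSet (x : I.E → ℝ) : F ⊕ W → Finset I.E
  | Sum.inl f => I.potentialHead x f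
  | Sum.inr w => I.head x (Sum.inr w)

/-- The singular vertices, i.e. the set `V^0` produced by the cleaning procedure. -/
inductive Singular (x : I.E → ℝ) : F ⊕ W → Prop
  | deficit (w : W) (e : I.E) (hw : I.FullyFilled x (Sum.inr w)) (he : e ∈ I.head x (Sum.inr w))
      (hd : I.Deficit x (I.firm e)) : Singular x (Sum.inr w)
  | empty (f : F) (hf : I.FullyFilled x (Sum.inl f)) (hD : I.potentialHead x f = ∅) :
      Singular x (Sum.inl f)
  | step (v u : F ⊕ W) (e : I.E) (hv : I.FullyFilled x v) (he : e ∈ I.outSet x v)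
      (hu : IsEnd u e.1) (hs : Singular x u) : Singular x v

/-- The regular vertices `V^+`: fully filled and not singular. -/
def Regular (x : I.E → ℝ) (v : F ⊕ W) : Prop := I.FullyFilled x v ∧ ¬ I.Singular x v

/-- `e` is active because of its end `v`: `v = f ∈ F^+` and `e ∈ D_f(x)`, or `v = w ∈ W^+` and
`e ∈ H_w(x)`. -/
def ActiveAt (x : I.E → ℝ) (v : F ⊕ W) (e : I.E) : Prop := I.Regular x v ∧ e ∈ I.outSet x v

/-- The set of active edges (the edge set of the active graph). -/
def activeEdges (x : I.E → ℝ) : Set I.E := {e | ∃ v, I.ActiveAt x v e}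

/-- The directed active graph: an arc `(f, w)` for each active `fw ∈ D_f(x)` and an arc `(w, f)`
for each active `fw ∈ H_w(x)`. (Vertices of `F ⊕ W` not covered by active edges are isolated.) -/
def activeGraph (x : I.E → ℝ) : Digraph (F ⊕ W) where
  Adj u v := u ≠ v ∧ ∃ e, I.ActiveAt x u e ∧ IsEnd v e.1

open Classical in
/-- The system of linear constraints (with right-hand side `ε`) in the variables `φ` on `F^+`
and `ψ` on `W^+`; values of `φ`, `ψ` outside `F^+`, `W^+` play no role. -/
structure IsLPSolution [Fintype F] [Fintype W] (x : I.E → ℝ) (ε : ℝ) (φ : F → ℝ) (ψ : W → ℝ) :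
    Prop where
  lp1 : ∀ f, I.Regular x (Sum.inl f) →
    ((I.potentialHead x f).card : ℝ) * φ f -
      ∑ e ∈ I.star (Sum.inl f) with I.ActiveAt x (I.worker e) e, ψ e.1.2 = 0
  lp2 : ∀ w, I.Regular x (Sum.inr w) →
    ((I.head x (Sum.inr w)).card : ℝ) * ψ w -
      ∑ e ∈ I.star (Sum.inr w) with I.ActiveAt x (I.firm e) e, φ e.1.1 = 0
  lp3 : ∑ f with I.Regular x (Sum.inl f), ((I.potentialHead x f).card : ℝ) * φ f +
      ∑ w with I.Regular x (Sum.inr w), ((I.head x (Sum.inr w)).card : ℝ) * ψ w = ε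
  lp4_phi : ∀ f, I.Regular x (Sum.inl f) → 0 ≤ φ f
  lp4_psi : ∀ w, I.Regular x (Sum.inr w) → 0 ≤ ψ w

end SMP

/-- The subgraph of `D` induced by `S` is strongly connected: any two vertices of `S` are joined by
a directed path inside `S`. -/
def Digraph.StronglyConnectedOn {V : Type*} (D : Digraph V) (S : Set V) : Prop :=
  ∀ u ∈ S, ∀ v ∈ S, Relation.ReflTransGen (fun a b => a ∈ S ∧ b ∈ S ∧ D.Adj a b) u v

/-- `S` is the vertex set of a strong component of `D`: inclusion-maximal among the vertex sets with
more than one element that induce a strongly connected subgraph. -/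
def Digraph.IsStrongComponent {V : Type*} (D : Digraph V) (S : Set V) : Prop :=
  Maximal (fun T : Set V => T.Nontrivial ∧ D.StronglyConnectedOn T) S

/-! ### Ties, the critical tie and the cutting height at one vertex. -/

namespace SMP

variable {F W : Type*} {I : SMP F W} {v : F ⊕ W}

/-! Ties and cutting heights are absorbed into one predicate: `Wants v x e` holds if `v` has free
quota, or some positive edge at `v` is worse than `e`, or is no better than `e` and carries more. A
choice is then a subvector within the quota all of whose cut edges are unwanted; stability means
that no unsaturated edge is wanted at both ends; heads of full vertices are the positive unwanted
edges, tails the wanted ones.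

All four conditions are tied to the existence of a regular vertex. A regular vertex has a nonempty
out-set, and the arcs along it lead to regular vertices (`ActiveAt.regular_otherEnd`); in a finite
graph this gives active edges and a strong component, and conversely every active arc starts at a
regular vertex.

If `x` is not maximal, the workers' choice from `x ∨ y`, for a suitable stable `y`, is a stable `z ≠
x` (`exists_stable_preferred`). Vertices where `z` and `x` differ escape every rule that creates
singular vertices, so they are regular (`exists_regular_of_preferred`).

If regular vertices exist, the uniform random walk along out-sets has a stationary distribution, and
its flow per edge solves the linear system (`exists_isLPSolution`). Conversely, a small move along a
solution with `ε > 0` keeps `x` stable and raises an edge that its worker wants, so `x` is not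
maximal (`not_isXMax_of_isLPSolution`). -/

theorem mem_star {e : I.E} : e ∈ I.star v ↔ IsEnd v e.1 := by
  simp [star]

theorem ge_total_star {a c : I.E} (ha : a ∈ I.star v) (hc : c ∈ I.star v) :
    I.ge v a c ∨ I.ge v c a :=
  I.ge_total v a c (mem_star.1 ha) (mem_star.1 hc)

theorem ge_refl_star {a : I.E} (ha : a ∈ I.star v) : I.ge v a a :=
  (ge_total_star ha ha).elim id id

theorem ge_trans_star {a c d : I.E} (ha : a ∈ I.star v) (hc : c ∈ I.star v) (hd : d ∈ I.star v)
    (h₁ : I.ge v a c) (h₂ : I.ge v c d) : I.ge v a d :=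
  I.ge_trans v a c d (mem_star.1 ha) (mem_star.1 hc) (mem_star.1 hd) h₁ h₂

theorem ge_of_not_ge {a c : I.E} (ha : a ∈ I.star v) (hc : c ∈ I.star v) (h : ¬ I.ge v a c) :
    I.ge v c a :=
  (ge_total_star ha hc).resolve_left h

theorem exists_best {s : Finset I.E} (hs : s ⊆ I.star v) (hne : s.Nonempty) :
    ∃ a ∈ s, ∀ c ∈ s, I.ge v a c := by
  classical
  induction hne using Finset.Nonempty.cons_induction with
  | singleton a => exact ⟨a, by simp, by simpa using ge_refl_star (hs (by simp))⟩
  | cons a s ha hne ih =>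
    obtain ⟨m, hm, hmax⟩ := ih (fun c hc => hs (by simp [hc]))
    have hms : m ∈ I.star v := hs (by simp [hm])
    have has : a ∈ I.star v := hs (by simp)
    rcases ge_total_star hms has with h | h
    · refine ⟨m, by simp [hm], fun c hc => ?_⟩
      rcases Finset.mem_cons.1 hc with rfl | hc
      · exact h
      · exact hmax c hc
    · refine ⟨a, by simp, fun c hc => ?_⟩
      have hcs := hs hc
      rcases Finset.mem_cons.1 hc with rfl | hc
      · exact ge_refl_star has
      · exact ge_trans_star has hms hcs h (hmax c hc)

theorem exists_worst {s : Finset I.E} (hs : s ⊆ I.star v) (hne : s.Nonempty) :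
    ∃ a ∈ s, ∀ c ∈ s, I.ge v c a := by
  classical
  induction hne using Finset.Nonempty.cons_induction with
  | singleton a => exact ⟨a, by simp, by simpa using ge_refl_star (hs (by simp))⟩
  | cons a s ha hne ih =>
    obtain ⟨m, hm, hmax⟩ := ih (fun c hc => hs (by simp [hc]))
    have hms : m ∈ I.star v := hs (by simp [hm])
    have has : a ∈ I.star v := hs (by simp)
    rcases ge_total_star has hms with h | h
    · refine ⟨m, by simp [hm], fun c hc => ?_⟩
      rcases Finset.mem_cons.1 hc with rfl | hc
      · exact h
      · exact hmax c hc
    · refine ⟨a, by simp, fun c hc => ?_⟩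
      have hcs := hs hc
      rcases Finset.mem_cons.1 hc with rfl | hc
      · exact ge_refl_star has
      · exact ge_trans_star hcs hms has (hmax c hc) h

theorem mem_before {e a : I.E} : a ∈ I.before v e ↔ a ∈ I.star v ∧ I.gt v a e := by
  simp [before]

theorem mem_upTo {e a : I.E} : a ∈ I.upTo v e ↔ a ∈ I.star v ∧ I.ge v a e := by
  simp [upTo]

theorem mem_critical {z : I.E → ℝ} {e : I.E} : e ∈ I.critical v z ↔ e ∈ I.star v ∧
    ∑ a ∈ I.before v e, z a < I.q v ∧ I.q v ≤ ∑ a ∈ I.upTo v e, z a := by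
  simp [critical]

theorem mem_beg {z : I.E → ℝ} {e : I.E} :
    e ∈ I.beg v z ↔ e ∈ I.star v ∧ ∃ c ∈ I.critical v z, I.gt v e c := by
  simp [beg]

/-- The best edge `k` whose tie and better ties reach the quota works: if the better ties alone
reached it, the worst edge among them would be a better choice than `k`. -/
theorem exists_mem_critical {z : I.E → ℝ} (hq : I.q v ≤ I.load v z) :
    ∃ k, k ∈ I.critical v z := by
  classical
  let s := (I.star v).filter fun e => I.q v ≤ ∑ a ∈ I.upTo v e, z a
  have hs : s ⊆ I.star v := Finset.filter_subset _ _
  have hstar : (I.star v).Nonempty := by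
    by_contra h
    rw [Finset.not_nonempty_iff_eq_empty] at h
    have := I.q_pos v
    simp [load, h] at hq
    linarith
  obtain ⟨m, hm, hworst⟩ := exists_worst (Finset.Subset.refl (I.star v)) hstar
  have hup : I.upTo v m = I.star v := by
    ext a
    rw [mem_upTo]
    exact ⟨fun h => h.1, fun h => ⟨h, hworst a h⟩⟩
  have hne : s.Nonempty := ⟨m, Finset.mem_filter.2 ⟨hm, by rwa [hup]⟩⟩
  obtain ⟨k, hk, hbest⟩ := exists_best hs hne
  refine ⟨k, mem_critical.2 ⟨hs hk, ?_, (Finset.mem_filter.1 hk).2⟩⟩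
  by_contra hlt
  push Not at hlt
  rcases (I.before v k).eq_empty_or_nonempty with hb | hb
  · have := I.q_pos v
    simp [hb] at hlt
    linarith
  have hbs : I.before v k ⊆ I.star v := fun a ha => (mem_before.1 ha).1
  obtain ⟨a, ha, haw⟩ := exists_worst hbs hb
  have hua : I.upTo v a = I.before v k := by
    ext c
    rw [mem_upTo]
    refine ⟨fun h => mem_before.2 ⟨h.1, ge_trans_star h.1 (hbs ha) (hs hk) h.2 (mem_before.1 ha).2.1,
      fun h' => (mem_before.1 ha).2.2 (ge_trans_star (hs hk) h.1 (hbs ha) h' h.2)⟩,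
      fun h => ⟨hbs h, haw c h⟩⟩
  exact (mem_before.1 ha).2.2 (hbest a (Finset.mem_filter.2 ⟨hbs ha, by rwa [hua]⟩))

/-- Partial sums of a nonnegative `z` are monotone along the ties, so the quota is crossed in only
one of them. -/
theorem mem_critical_iff {z : I.E → ℝ} (hz : ∀ e ∈ I.star v, 0 ≤ z e) {k : I.E}
    (hk : k ∈ I.critical v z) {e : I.E} :
    e ∈ I.critical v z ↔ e ∈ I.star v ∧ I.ge v e k ∧ I.ge v k e := by
  have key : ∀ a ∈ I.critical v z, ∀ c ∈ I.critical v z, I.ge v a c := by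
    intro a ha c hc
    by_contra h
    rw [mem_critical] at ha hc
    have hca := ge_of_not_ge ha.1 hc.1 h
    have hle : ∑ i ∈ I.upTo v c, z i ≤ ∑ i ∈ I.before v a, z i := by
      refine Finset.sum_le_sum_of_subset_of_nonneg ?_ fun i hi _ => hz i (mem_before.1 hi).1
      intro i hi
      rw [mem_upTo] at hi
      exact mem_before.2 ⟨hi.1, ge_trans_star hi.1 hc.1 ha.1 hi.2 hca,
        fun h' => h (ge_trans_star ha.1 hi.1 hc.1 h' hi.2)⟩
    linarith [ha.2.1, hc.2.2]
  refine ⟨fun he => ⟨(mem_critical.1 he).1, key e he k hk, key k hk e he⟩, ?_⟩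
  rintro ⟨he, hek, hke⟩
  rw [mem_critical] at hk ⊢
  have h1 : I.before v e = I.before v k := by
    ext i
    simp only [mem_before, gt]
    refine and_congr_right fun hi => ?_
    exact and_congr ⟨fun h => ge_trans_star hi he hk.1 h hek, fun h => ge_trans_star hi hk.1 he h hke⟩
      (not_congr ⟨fun h => ge_trans_star hk.1 he hi hke h, fun h => ge_trans_star he hk.1 hi hek h⟩)
  have h2 : I.upTo v e = I.upTo v k := by
    ext i
    simp only [mem_upTo]
    refine and_congr_right fun hi => ?_
    exact ⟨fun h => ge_trans_star hi he hk.1 h hek, fun h => ge_trans_star hi hk.1 he h hke⟩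
  rw [h1, h2]
  exact ⟨he, hk.2⟩

theorem mem_beg_iff {z : I.E → ℝ} (hz : ∀ e ∈ I.star v, 0 ≤ z e) {k : I.E}
    (hk : k ∈ I.critical v z) {e : I.E} :
    e ∈ I.beg v z ↔ e ∈ I.star v ∧ I.gt v e k := by
  have hks := (mem_critical.1 hk).1
  rw [mem_beg]
  refine and_congr_right fun he => ⟨?_, fun h => ⟨k, hk, h⟩⟩
  rintro ⟨c, hc, hec, hce⟩
  obtain ⟨hcs, hck, hkc⟩ := (mem_critical_iff hz hk).1 hc
  exact ⟨ge_trans_star he hcs hks hec hck, fun h => hce (ge_trans_star hcs hks he hck h)⟩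

theorem disjoint_beg_critical {z : I.E → ℝ} (hz : ∀ e ∈ I.star v, 0 ≤ z e) :
    Disjoint (I.beg v z) (I.critical v z) := by
  rw [Finset.disjoint_left]
  intro a ha hk
  exact ((mem_beg_iff hz hk).1 ha).2.2 ((mem_beg_iff hz hk).1 ha).2.1

theorem beg_subset_star {z : I.E → ℝ} : I.beg v z ⊆ I.star v := fun _ h => (mem_beg.1 h).1

theorem critical_subset_star {z : I.E → ℝ} : I.critical v z ⊆ I.star v :=
  fun _ h => (mem_critical.1 h).1

theorem beg_eq_before {z : I.E → ℝ} (hz : ∀ e ∈ I.star v, 0 ≤ z e) {k : I.E}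
    (hk : k ∈ I.critical v z) : I.beg v z = I.before v k := by
  ext e
  rw [mem_beg_iff hz hk, mem_before]

open Classical in
theorem beg_union_critical_eq_upTo {z : I.E → ℝ} (hz : ∀ e ∈ I.star v, 0 ≤ z e) {k : I.E}
    (hk : k ∈ I.critical v z) : I.beg v z ∪ I.critical v z = I.upTo v k := by
  ext e
  rw [Finset.mem_union, mem_beg_iff hz hk, mem_critical_iff hz hk, mem_upTo, gt]
  tauto

theorem cut_spec {z : I.E → ℝ} (hz : ∀ e ∈ I.star v, 0 ≤ z e) (hq : I.q v ≤ I.load v z) :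
    0 < I.cut v z ∧
      ∑ e ∈ I.beg v z, z e + ∑ e ∈ I.critical v z, min (I.cut v z) (z e) = I.q v ∧
      ∀ r, ∑ e ∈ I.beg v z, z e + ∑ e ∈ I.critical v z, min r (z e) = I.q v → I.cut v z ≤ r := by
  classical
  obtain ⟨k, hk⟩ := exists_mem_critical hq
  set g : ℝ → ℝ := fun r => ∑ e ∈ I.beg v z, z e + ∑ e ∈ I.critical v z, min r (z e) with hg
  have hcont : Continuous g := by fun_prop
  have hbeg : ∑ e ∈ I.beg v z, z e < I.q v := by
    rw [beg_eq_before hz hk]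
    exact (mem_critical.1 hk).2.1
  have hpos : ∀ r, g r = I.q v → 0 < r := by
    intro r hr
    by_contra h
    push Not at h
    have : ∑ e ∈ I.critical v z, min r (z e) ≤ 0 :=
      Finset.sum_nonpos fun e _ => (min_le_left _ _).trans h
    simp only [hg] at hr
    linarith
  have hbdd : BddBelow {r | g r = I.q v} := ⟨0, fun r hr => (hpos r hr).le⟩
  have hne : {r | g r = I.q v}.Nonempty := by
    obtain ⟨M, hM⟩ : ∃ M, ∀ e ∈ I.critical v z, z e ≤ M :=
      ⟨∑ e ∈ I.critical v z, z e, fun e he =>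
        Finset.single_le_sum (fun i hi => hz i (critical_subset_star hi)) he⟩
    have hM0 : 0 ≤ M := (hz k (critical_subset_star hk)).trans (hM k hk)
    have h0 : g 0 ≤ I.q v := by
      have : ∑ e ∈ I.critical v z, min 0 (z e) ≤ 0 :=
        Finset.sum_nonpos fun e _ => min_le_left _ _
      simp only [hg]
      linarith
    have h1 : I.q v ≤ g M := by
      have h2 : ∑ e ∈ I.critical v z, min M (z e) = ∑ e ∈ I.critical v z, z e :=
        Finset.sum_congr rfl fun e he => min_eq_right (hM e he)
      have h3 := (mem_critical.1 hk).2.2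
      rw [← beg_union_critical_eq_upTo hz hk,
        Finset.sum_union (disjoint_beg_critical hz)] at h3
      simp only [hg, h2]
      exact h3
    obtain ⟨r, -, hr⟩ := intermediate_value_Icc hM0 hcont.continuousOn ⟨h0, h1⟩
    exact ⟨r, hr⟩
  -- The solution set is closed, nonempty by the intermediate value theorem and bounded below by
  -- `0`, so the infimum is attained.
  have hmem : I.cut v z ∈ {r | g r = I.q v} :=
    (isClosed_eq hcont continuous_const).csInf_mem hne hbdd
  exact ⟨hpos _ hmem, hmem, fun r hr => csInf_le hbdd hr⟩

/-! ### The choice function expressed through wanted edges. -/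

/-- Some more of `e` would be accepted by `v` in addition to `x_v`. -/
def Wants (I : SMP F W) (v : F ⊕ W) (x : I.E → ℝ) (e : I.E) : Prop :=
  I.load v x < I.q v ∨ ∃ c ∈ I.star v, 0 < x c ∧ (I.gt v e c ∨ (I.ge v e c ∧ x e < x c))

theorem not_wants_iff {x : I.E → ℝ} {e : I.E} (he : e ∈ I.star v) :
    ¬ I.Wants v x e ↔ I.q v ≤ I.load v x ∧
      ∀ c ∈ I.star v, 0 < x c → I.ge v c e ∧ (I.ge v e c → x c ≤ x e) := by
  simp only [Wants, gt]
  push Not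
  refine and_congr_right fun _ => forall_congr' fun c => forall_congr' fun hc =>
    forall_congr' fun _ => and_congr_left fun _ => ⟨fun h => ?_, fun h _ => h⟩
  exact (ge_total_star he hc).elim h id

/-- Axiomatic description of the relation `y = C_v(z)`. -/
structure IsChoice (I : SMP F W) (v : F ⊕ W) (z y : I.E → ℝ) : Prop where
  nonneg : ∀ e ∈ I.star v, 0 ≤ y e
  le : ∀ e ∈ I.star v, y e ≤ z e
  load_le : I.load v y ≤ I.q v
  not_wants : ∀ e ∈ I.star v, y e < z e → ¬ I.Wants v y e

/-- Truncation fills the quota exactly, and an edge that is cut carries either the common height `r`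
in the critical tie or `0` below it; neither is wanted. -/
theorem isChoice_choice {z : I.E → ℝ} (hz : ∀ e ∈ I.star v, 0 ≤ z e) :
    I.IsChoice v z (I.choice v z) := by
  classical
  by_cases hl : I.load v z ≤ I.q v
  · have h : I.choice v z = z := by
      funext e
      simp [choice, hl]
    rw [h]
    exact ⟨hz, fun _ _ => le_rfl, hl, fun e _ h => absurd h (lt_irrefl _)⟩
  push Not at hl
  obtain ⟨k, hk⟩ := exists_mem_critical hl.le
  obtain ⟨hr0, hr, -⟩ := cut_spec hz hl.le
  have hks := critical_subset_star hk
  set r := I.cut v z with hrdef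
  have hbegv : ∀ e ∈ I.beg v z, I.choice v z e = z e := fun e he => by
    simp [choice, hl.not_ge, he]
  have hcritv : ∀ e ∈ I.critical v z, I.choice v z e = min r (z e) := fun e he => by
    have : e ∉ I.beg v z := fun h => Finset.disjoint_left.1 (disjoint_beg_critical hz) h he
    simp [choice, hl.not_ge, he, this, hrdef]
  have hrest : ∀ e, e ∉ I.beg v z → e ∉ I.critical v z → I.choice v z e = 0 := fun e h1 h2 => by
    simp [choice, hl.not_ge, h1, h2]
  have hload : I.load v (I.choice v z) = I.q v := by
    rw [load, ← Finset.sum_subset (Finset.union_subset beg_subset_star critical_subset_star)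
      (fun e _ he => hrest e (fun h => he (Finset.mem_union_left _ h))
        (fun h => he (Finset.mem_union_right _ h))),
      Finset.sum_union (disjoint_beg_critical hz), Finset.sum_congr rfl hbegv,
      Finset.sum_congr rfl hcritv, hr]
  refine ⟨fun e he => ?_, fun e he => ?_, hload.le, fun e he hlt => ?_⟩
  · by_cases h1 : e ∈ I.beg v z
    · rw [hbegv e h1]; exact hz e he
    by_cases h2 : e ∈ I.critical v z
    · rw [hcritv e h2]; exact le_min hr0.le (hz e he)
    rw [hrest e h1 h2]
  · by_cases h1 : e ∈ I.beg v z
    · rw [hbegv e h1]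
    by_cases h2 : e ∈ I.critical v z
    · rw [hcritv e h2]; exact min_le_right _ _
    rw [hrest e h1 h2]; exact hz e he
  · rw [not_wants_iff he]
    refine ⟨hload.ge, fun c hc hpos => ?_⟩
    have h1 : e ∉ I.beg v z := fun h => by rw [hbegv e h] at hlt; exact lt_irrefl _ hlt
    have hke : I.ge v k e := by
      by_contra h
      exact h1 ((mem_beg_iff hz hk).2 ⟨he, ge_of_not_ge hks he h, h⟩)
    by_cases hcb : c ∈ I.beg v z
    · have hck := ((mem_beg_iff hz hk).1 hcb).2
      exact ⟨ge_trans_star hc hks he hck.1 hke,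
        fun h => absurd (ge_trans_star hks he hc hke h) hck.2⟩
    by_cases hcc : c ∈ I.critical v z
    · have hck := ((mem_critical_iff hz hk).1 hcc).2
      refine ⟨ge_trans_star hc hks he hck.1 hke, fun h => ?_⟩
      have hec : e ∈ I.critical v z :=
        (mem_critical_iff hz hk).2 ⟨he, ge_trans_star he hc hks h hck.1, hke⟩
      rw [hcritv e hec] at hlt ⊢
      rw [hcritv c hcc]
      have : min r (z e) = r := min_eq_left (by
        by_contra h'
        push Not at h'
        rw [min_eq_right h'.le] at hlt
        exact lt_irrefl _ hlt)
      rw [this]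
      exact min_le_left _ _
    · rw [hrest c hcb hcc] at hpos
      exact absurd hpos (lt_irrefl _)

theorem exists_lt_of_load_le {x y : I.E → ℝ} (h : I.load v y ≤ I.load v x) {e : I.E}
    (he : e ∈ I.star v) (hlt : x e < y e) : ∃ c ∈ I.star v, y c < x c := by
  by_contra hc
  push Not at hc
  exact absurd h (not_le.2 (Finset.sum_lt_sum hc ⟨e, he, hlt⟩))

theorem eqOn_of_le_of_load_le {x y : I.E → ℝ} (h : I.load v y ≤ I.load v x)
    (hle : ∀ e ∈ I.star v, x e ≤ y e) : ∀ e ∈ I.star v, x e = y e := by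
  intro e he
  refine (hle e he).antisymm (le_of_not_gt fun hlt => ?_)
  obtain ⟨c, hc, hc'⟩ := exists_lt_of_load_le h he hlt
  exact absurd hc' (not_lt.2 (hle c hc))

/-- If every edge on which `z` falls below `x` is unwanted under `z`, then `z` cannot exceed `x`
on an edge that is unwanted under `x`. -/
theorem le_of_not_wants {x z : I.E → ℝ} (hx : ∀ e ∈ I.star v, 0 ≤ x e)
    (hz : ∀ e ∈ I.star v, 0 ≤ z e) (hl : I.load v z ≤ I.q v)
    (hpref : ∀ c ∈ I.star v, z c < x c → ¬ I.Wants v z c) {e : I.E} (he : e ∈ I.star v)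
    (hw : ¬ I.Wants v x e) : z e ≤ x e := by
  by_contra h
  push Not at h
  obtain ⟨hq, hx'⟩ := (not_wants_iff he).1 hw
  -- Since `x` fills the quota, an excess at `e` is paid for by some `c`. The two unwantedness
  -- conditions put `c` and `e` in one tie, and `z e ≤ z c < x c ≤ x e`.
  obtain ⟨c, hc, hlt⟩ := exists_lt_of_load_le (hl.trans hq) he h
  have h1 := ((not_wants_iff hc).1 (hpref c hc hlt)).2 e he ((hx e he).trans_lt h)
  have h2 := hx' c hc ((hz c hc).trans_lt hlt)
  linarith [h1.2 h2.1, h2.2 h1.1]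

/-- An edge `c` that rises from `x` to `z` forces another edge `d` to drop; comparing `c` with `d`
under `z`, and `d` with `e` under `x`, shows that `c` cannot make `e` wanted. Edges that do not rise
were harmless already. -/
theorem not_wants_of_eq {x z : I.E → ℝ}
    (hz : ∀ e ∈ I.star v, 0 ≤ z e) (hl : I.load v z ≤ I.q v)
    (hload : I.load v x ≤ I.load v z)
    (hpref : ∀ c ∈ I.star v, z c < x c → ¬ I.Wants v z c) {e : I.E} (he : e ∈ I.star v)
    (hw : ¬ I.Wants v x e) (hxe : x e ≤ z e) : ¬ I.Wants v z e := by
  obtain ⟨hq, hx'⟩ := (not_wants_iff he).1 hw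
  have key : ∀ c ∈ I.star v, 0 < z c → x c < z c →
      I.ge v c e ∧ (I.ge v e c → z c ≤ z e) := by
    intro c hc _ hlt
    obtain ⟨d, hd, hdlt⟩ := exists_lt_of_load_le (hl.trans hq) hc hlt
    have h1 := ((not_wants_iff hd).1 (hpref d hd hdlt)).2 c hc (by assumption)
    have h2 := hx' d hd ((hz d hd).trans_lt hdlt)
    refine ⟨ge_trans_star hc hd he h1.1 h2.1, fun hec => ?_⟩
    have hdc := ge_trans_star hd he hc h2.1 hec
    have hed := ge_trans_star he hc hd hec h1.1
    linarith [h1.2 hdc, h2.2 hed]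
  rw [not_wants_iff he]
  refine ⟨hq.trans hload, fun c hc hpos => ?_⟩
  rcases lt_or_ge (x c) (z c) with h | h
  · exact key c hc hpos h
  · have := hx' c hc (hpos.trans_le h)
    exact ⟨this.1, fun hec => by linarith [this.2 hec]⟩

theorem IsChoice.unique {z y y' : I.E → ℝ} (h : I.IsChoice v z y) (h' : I.IsChoice v z y') :
    ∀ e ∈ I.star v, y e = y' e := by
  have key : ∀ {y y' : I.E → ℝ}, I.IsChoice v z y → I.IsChoice v z y' →
      ∀ e ∈ I.star v, y' e ≤ y e := by
    intro y y' h h' e he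
    by_contra hlt
    push Not at hlt
    have hw := h.not_wants e he (hlt.trans_le (h'.le e he))
    exact absurd (le_of_not_wants h.nonneg h'.nonneg h'.load_le
      (fun c hc hcl => h'.not_wants c hc (hcl.trans_le (h.le c hc))) he hw) (not_le.2 hlt)
  exact fun e he => (key h' h e he).antisymm (key h h' e he)

theorem load_congr {x y : I.E → ℝ} (h : ∀ e ∈ I.star v, x e = y e) : I.load v x = I.load v y :=
  Finset.sum_congr rfl h

theorem Wants.congr {x y : I.E → ℝ} (h : ∀ e ∈ I.star v, x e = y e) {e : I.E}
    (he : e ∈ I.star v) (hw : I.Wants v x e) : I.Wants v y e := by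
  rcases hw with hw | ⟨c, hc, h0, h1⟩
  · left
    rwa [← load_congr h]
  · right
    rw [h e he, h c hc] at h1
    rw [h c hc] at h0
    exact ⟨c, hc, h0, h1⟩

theorem IsChoice.congr {z y y' : I.E → ℝ} (h : ∀ e ∈ I.star v, y e = y' e)
    (hy : I.IsChoice v z y) : I.IsChoice v z y' where
  nonneg e he := h e he ▸ hy.nonneg e he
  le e he := h e he ▸ hy.le e he
  load_le := load_congr h ▸ hy.load_le
  not_wants e he hlt hw :=
    hy.not_wants e he ((h e he).symm ▸ hlt) (hw.congr (fun e he => (h e he).symm) he)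

/-! ### Heads, tails and stability expressed through wanted edges. -/

/-- The load is exactly the quota, so nothing is left below the critical tie and the cut removes
nothing; being the least solution, it equals the maximum of `x` on that tie. -/
theorem head_spec {x : I.E → ℝ} (hx : ∀ e ∈ I.star v, 0 ≤ x e) (hf : I.FullyFilled x v) :
    (∀ e ∈ I.star v, 0 < x e → e ∈ I.beg v x ∨ e ∈ I.critical v x) ∧
    (∀ e ∈ I.critical v x, x e ≤ I.cut v x) ∧
    ∃ c ∈ I.critical v x, x c = I.cut v x := by
  classical
  have hq : I.q v ≤ I.load v x := hf.ge
  obtain ⟨k, hk⟩ := exists_mem_critical hq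
  obtain ⟨-, hr, hmin⟩ := cut_spec hx hq
  have hdis := disjoint_beg_critical (v := v) hx
  have hsub : I.beg v x ∪ I.critical v x ⊆ I.star v :=
    Finset.union_subset beg_subset_star critical_subset_star
  have htot : ∑ e ∈ I.beg v x ∪ I.critical v x, x e ≤ I.q v := by
    rw [← hf]
    exact Finset.sum_le_sum_of_subset_of_nonneg hsub fun e he _ => hx e he
  have hup : I.q v ≤ ∑ e ∈ I.beg v x ∪ I.critical v x, x e := by
    rw [beg_union_critical_eq_upTo hx hk]
    exact (mem_critical.1 hk).2.2
  have htot' := htot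
  rw [Finset.sum_union hdis] at htot'
  have hcut : ∀ e ∈ I.critical v x, x e ≤ I.cut v x := by
    have h1 : ∑ e ∈ I.critical v x, min (I.cut v x) (x e) = ∑ e ∈ I.critical v x, x e :=
      le_antisymm (Finset.sum_le_sum fun e _ => min_le_right _ _) (by linarith)
    intro e he
    have := (Finset.sum_eq_sum_iff_of_le fun e _ => min_le_right (I.cut v x) (x e)).1 h1 e he
    exact min_eq_right_iff.1 this
  refine ⟨fun e he hpos => ?_, hcut, ?_⟩
  · by_contra hn
    have hlt : ∑ e ∈ I.beg v x ∪ I.critical v x, x e < ∑ e ∈ I.star v, x e :=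
      Finset.sum_lt_sum_of_subset hsub he (by simpa using hn) hpos fun e he _ => hx e he
    rw [← load, hf] at hlt
    linarith
  · obtain ⟨c, hc, hmax⟩ := Finset.exists_max_image (I.critical v x) x ⟨k, hk⟩
    refine ⟨c, hc, (hcut c hc).antisymm (hmin _ ?_)⟩
    rw [← Finset.sum_union hdis] at htot'
    rw [Finset.sum_congr rfl fun e he => min_eq_right (hmax e he), ← Finset.sum_union hdis]
    exact htot'.antisymm hup

/-- An edge `k` of maximal height in the critical tie is positive, so an unwanted positive edge must
be no better than `k` and, within the tie, as high as `k`. -/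
theorem mem_head_iff {x : I.E → ℝ} (hx : ∀ e ∈ I.star v, 0 ≤ x e) (hf : I.FullyFilled x v)
    {e : I.E} : e ∈ I.head x v ↔ e ∈ I.star v ∧ 0 < x e ∧ ¬ I.Wants v x e := by
  classical
  obtain ⟨h1, h2, k, hk, hkv⟩ := head_spec hx hf
  have hpos := (cut_spec hx hf.ge).1
  have hks := critical_subset_star hk
  rw [head, if_pos hf, Finset.mem_filter]
  constructor
  · rintro ⟨he, hev⟩
    have hes := critical_subset_star he
    refine ⟨hes, hev ▸ hpos, (not_wants_iff hes).2 ⟨hf.ge, fun c hc hc0 => ?_⟩⟩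
    rcases h1 c hc hc0 with hc' | hc'
    · have := (mem_beg_iff hx he).1 hc'
      exact ⟨this.2.1, fun h => absurd h this.2.2⟩
    · exact ⟨((mem_critical_iff hx he).1 hc').2.1, fun _ => hev ▸ h2 c hc'⟩
  · rintro ⟨he, he0, hw⟩
    have h3 := ((not_wants_iff he).1 hw).2 k hks (hkv ▸ hpos)
    have hec : e ∈ I.critical v x := by
      refine (h1 e he he0).resolve_left fun hb => ?_
      exact ((mem_beg_iff hx hk).1 hb).2.2 h3.1
    exact ⟨hec, (h2 e hec).antisymm (hkv ▸ h3.2 ((mem_critical_iff hx hk).1 hec).2.1)⟩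

theorem mem_tail_iff {x : I.E → ℝ} (hx : ∀ e ∈ I.star v, 0 ≤ x e) (hl : I.load v x ≤ I.q v)
    {e : I.E} : e ∈ I.tail x v ↔ e ∈ I.star v ∧ I.Wants v x e := by
  classical
  by_cases hf : I.FullyFilled x v
  swap
  · rw [tail, if_neg hf]
    exact ⟨fun h => ⟨h, Or.inl (hl.lt_of_ne hf)⟩, fun h => h.1⟩
  obtain ⟨h1, h2, k, hk, hkv⟩ := head_spec hx hf
  have hpos := (cut_spec hx hf.ge).1
  have hks := critical_subset_star hk
  rw [tail, if_pos hf, Finset.mem_union, Finset.mem_sdiff, mem_head_iff hx hf]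
  constructor
  · rintro (he | ⟨he, hn⟩)
    · have := (mem_beg_iff hx hk).1 he
      exact ⟨this.1, Or.inr ⟨k, hks, hkv ▸ hpos, Or.inl this.2⟩⟩
    · have hes := critical_subset_star he
      refine ⟨hes, ?_⟩
      by_contra hw
      rcases (hx e hes).lt_or_eq with h0 | h0
      · exact hn ⟨hes, h0, hw⟩
      · refine hw (Or.inr ⟨k, hks, hkv ▸ hpos, Or.inr ⟨((mem_critical_iff hx hk).1 he).2.1, ?_⟩⟩)
        rw [← h0, hkv]
        exact hpos
  · rintro ⟨he, hw⟩
    by_cases hb : e ∈ I.beg v x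
    · exact Or.inl hb
    refine Or.inr ⟨?_, fun h => h.2.2 hw⟩
    have hke : I.ge v k e := by
      by_contra h
      exact hb ((mem_beg_iff hx hk).2 ⟨he, ge_of_not_ge hks he h, h⟩)
    refine (mem_critical_iff hx hk).2 ⟨he, ?_, hke⟩
    rcases hw with hw | ⟨c, hc, hc0, hec⟩
    · exact absurd hf hw.ne
    have hec' : I.ge v e c := hec.elim (fun h => h.1) fun h => h.1
    rcases h1 c hc hc0 with h | h
    · exact ge_trans_star he hc hks hec' ((mem_beg_iff hx hk).1 h).2.1
    · exact ge_trans_star he hc hks hec' ((mem_critical_iff hx hk).1 h).2.1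

theorem fullyStationary_iff {x : I.E → ℝ} :
    I.FullyStationary x ↔ I.Admissible x ∧ ∀ v, I.load v x ≤ I.q v := by
  refine and_congr_right fun hadm => forall_congr' fun v => ⟨fun h => ?_, fun h e _ => ?_⟩
  · rw [← load_congr h]
    exact (isChoice_choice fun e _ => (hadm e).1).load_le
  · simp [choice, h]

theorem interesting_iff {x : I.E → ℝ} (hadm : I.Admissible x) (hl : I.load v x ≤ I.q v)
    {e : I.E} : I.Interesting v x e ↔ e ∈ I.star v ∧ I.Unsaturated x e ∧ I.Wants v x e := by
  classical
  refine and_congr_right fun he => ⟨?_, ?_⟩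
  · rintro ⟨z, hz, hlt, heq, hch⟩
    refine ⟨hlt.trans_le (hz e).2, ?_⟩
    by_contra hw
    have hc := isChoice_choice (v := v) fun e _ => (hz e).1
    refine absurd (le_of_not_wants (fun e _ => (hadm e).1) hc.nonneg hc.load_le
      (fun c hcs hlt' => hc.not_wants c hcs (hlt'.trans_le ?_)) he hw) (not_le.2 hch)
    by_cases h : c = e
    · exact h ▸ hlt.le
    · exact (heq c hcs h).ge
  · rintro ⟨hu, hw⟩
    -- The test offer raises `e` to its capacity. If no increase were accepted, the choice would lie
    -- below `x` and have a full load, hence equal `x`, and `e` would be unwanted.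
    have hadm' : I.Admissible (Function.update x e (I.b e)) := by
      intro a
      by_cases h : a = e
      · subst h
        simpa using (I.b_pos a).le
      · simpa [h] using hadm a
    refine ⟨Function.update x e (I.b e), hadm', by rw [Function.update_self]; exact hu, fun a _ ha => by simp [ha], ?_⟩
    have hc := isChoice_choice (v := v) fun e _ => (hadm' e).1
    by_contra hle
    push Not at hle
    set y := I.choice v (Function.update x e (I.b e))
    have hyx : ∀ a ∈ I.star v, y a ≤ x a := fun a ha => by
      by_cases h : a = e
      · exact h ▸ hle
      · simpa [h] using hc.le a ha
    have hnw := hc.not_wants e he (by rw [Function.update_self]; exact hle.trans_lt hu)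
    have hq := ((not_wants_iff he).1 hnw).1
    exact hnw (hw.congr (fun a ha => (eqOn_of_le_of_load_le (hl.trans hq) hyx a ha).symm) he)

theorem mem_star_inl {f : F} {e : I.E} : e ∈ I.star (Sum.inl f) ↔ f = e.1.1 := by
  simp [mem_star, IsEnd]

theorem mem_star_inr {w : W} {e : I.E} : e ∈ I.star (Sum.inr w) ↔ w = e.1.2 := by
  simp [mem_star, IsEnd]

theorem mem_star_firm (e : I.E) : e ∈ I.star (I.firm e) := mem_star_inl.2 rfl

theorem mem_star_worker (e : I.E) : e ∈ I.star (I.worker e) := mem_star_inr.2 rfl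

theorem stable_iff {x : I.E → ℝ} : I.Stable x ↔ I.Admissible x ∧ (∀ v, I.load v x ≤ I.q v) ∧
    ∀ e, I.Unsaturated x e → I.Wants (I.firm e) x e → ¬ I.Wants (I.worker e) x e := by
  rw [Stable, fullyStationary_iff, and_assoc]
  refine and_congr_right fun hadm => and_congr_right fun hl => forall_congr' fun e => ?_
  rw [Blocking, interesting_iff hadm (hl _), interesting_iff hadm (hl _)]
  have := mem_star_firm e
  have := mem_star_worker e
  tauto

theorem IsChoice.eq_of_load_lt {z y : I.E → ℝ} (h : I.IsChoice v z y) (hl : I.load v y < I.q v) :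
    ∀ e ∈ I.star v, y e = z e := fun e he =>
  (h.le e he).antisymm (le_of_not_gt fun hlt => h.not_wants e he hlt (Or.inl hl))

theorem IsChoice.le_load {z y x : I.E → ℝ} (h : I.IsChoice v z y) (hxz : x ≤ z)
    (hl : I.load v x ≤ I.q v) : I.load v x ≤ I.load v y := by
  rcases lt_or_ge (I.load v y) (I.q v) with hlt | hge
  · rw [load_congr (h.eq_of_load_lt hlt)]
    exact Finset.sum_le_sum fun e _ => hxz e
  · exact hl.trans hge

/-! ### Joins of stable assignments and invariance of loads. -/

theorem sum_load_inl [Fintype F] (z : I.E → ℝ) : ∑ f : F, I.load (Sum.inl f) z = ∑ e, z e := by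
  classical
  rw [← Finset.sum_fiberwise (s := Finset.univ) (fun e : I.E => e.1.1) z]
  refine Finset.sum_congr rfl fun f _ => Finset.sum_congr ?_ fun _ _ => rfl
  ext e
  simp [mem_star_inl, eq_comm]

theorem sum_load_inr [Fintype W] (z : I.E → ℝ) : ∑ w : W, I.load (Sum.inr w) z = ∑ e, z e := by
  classical
  rw [← Finset.sum_fiberwise (s := Finset.univ) (fun e : I.E => e.1.2) z]
  refine Finset.sum_congr rfl fun f _ => Finset.sum_congr ?_ fun _ _ => rfl
  ext e
  simp [mem_star_inr, eq_comm]

/-- The two one-sided choices from `x ∨ y`, for stable `x` and `y`, add up to `x + y`, and have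
the same loads as `x` and `y`. -/
theorem Stable.exists_join_meet [Fintype F] [Fintype W] {x y : I.E → ℝ} (hx : I.Stable x)
    (hy : I.Stable y) : ∃ z u : I.E → ℝ,
      (∀ w, I.IsChoice (Sum.inr w) (x ⊔ y) z) ∧ (∀ f, I.IsChoice (Sum.inl f) (x ⊔ y) u) ∧
      (∀ e, z e = x e ∨ z e = y e) ∧
      (∀ v, I.load v y = I.load v x) ∧ (∀ v, I.load v z = I.load v x) ∧
      ∀ f, I.load (Sum.inl f) u = I.load (Sum.inl f) x := by
  obtain ⟨hxa, hxl, hxs⟩ := stable_iff.1 hx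
  obtain ⟨hya, hyl, hys⟩ := stable_iff.1 hy
  have hJ : ∀ e, 0 ≤ (x ⊔ y) e := fun e => le_sup_of_le_left (hxa e).1
  let z : I.E → ℝ := fun e => I.choice (I.worker e) (x ⊔ y) e
  let u : I.E → ℝ := fun e => I.choice (I.firm e) (x ⊔ y) e
  have hz : ∀ w, I.IsChoice (Sum.inr w) (x ⊔ y) z := fun w =>
    (isChoice_choice fun e _ => hJ e).congr fun e he => by
      rw [mem_star_inr] at he
      subst he
      rfl
  have hu : ∀ f, I.IsChoice (Sum.inl f) (x ⊔ y) u := fun f =>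
    (isChoice_choice fun e _ => hJ e).congr fun e he => by
      rw [mem_star_inl] at he
      subst he
      rfl
  have hxJ : x ≤ x ⊔ y := le_sup_left
  have hyJ : y ≤ x ⊔ y := le_sup_right
  have hzJ : ∀ e, z e ≤ max (x e) (y e) := fun e => (hz e.1.2).le e (mem_star_worker e)
  have huJ : ∀ e, u e ≤ max (x e) (y e) := fun e => (hu e.1.1).le e (mem_star_firm e)
  -- One end does not want the unsaturated edge `e` under `t`, and the choice of that end cannot
  -- exceed `t` there.
  have key : ∀ t : I.E → ℝ, I.Stable t → t ≤ x ⊔ y → ∀ e, t e < I.b e → z e ≤ t e ∨ u e ≤ t e := by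
    intro t ht htJ e hlt
    obtain ⟨hta, -, hts⟩ := stable_iff.1 ht
    by_cases hwf : I.Wants (I.firm e) t e
    · left
      exact le_of_not_wants (fun e _ => (hta e).1) (hz e.1.2).nonneg (hz e.1.2).load_le
        (fun c hc hlt => (hz e.1.2).not_wants c hc (hlt.trans_le (htJ c))) (mem_star_worker e)
        (hts e hlt hwf)
    · right
      exact le_of_not_wants (fun e _ => (hta e).1) (hu e.1.1).nonneg (hu e.1.1).load_le
        (fun c hc hlt => (hu e.1.1).not_wants c hc (hlt.trans_le (htJ c))) (mem_star_firm e) hwf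
  have hmin : ∀ e, z e ≤ min (x e) (y e) ∨ u e ≤ min (x e) (y e) := by
    intro e
    rcases lt_trichotomy (x e) (y e) with h | h | h
    · rw [min_eq_left h.le]
      exact key x hx hxJ e (h.trans_le (hya e).2)
    · left
      simpa [h] using hzJ e
    · rw [min_eq_right h.le]
      exact key y hy hyJ e (h.trans_le (hxa e).2)
  have hsum : ∀ e, z e + u e ≤ x e + y e := by
    intro e
    have := max_add_min (x e) (y e)
    rcases hmin e with h | h
    · linarith [huJ e]
    · linarith [hzJ e]
  have hzx : ∀ w, I.load (Sum.inr w) x ≤ I.load (Sum.inr w) z := fun w =>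
    (hz w).le_load hxJ (hxl _)
  have hzy : ∀ w, I.load (Sum.inr w) y ≤ I.load (Sum.inr w) z := fun w =>
    (hz w).le_load hyJ (hyl _)
  have hux : ∀ f, I.load (Sum.inl f) x ≤ I.load (Sum.inl f) u := fun f =>
    (hu f).le_load hxJ (hxl _)
  have huy : ∀ f, I.load (Sum.inl f) y ≤ I.load (Sum.inl f) u := fun f =>
    (hu f).le_load hyJ (hyl _)
  -- Each of `z` and `u` has total at least those of `x` and `y`, while `z + u ≤ x + y`; hence all
  -- these inequalities are equalities, vertex by vertex and edge by edge.
  have h1 := Finset.sum_le_sum fun w (_ : w ∈ Finset.univ) => hzx w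
  have h2 := Finset.sum_le_sum fun w (_ : w ∈ Finset.univ) => hzy w
  have h3 := Finset.sum_le_sum fun w (_ : w ∈ Finset.univ) => hux w
  have h4 := Finset.sum_le_sum fun w (_ : w ∈ Finset.univ) => huy w
  have h5 := Finset.sum_le_sum fun e (_ : e ∈ Finset.univ) => hsum e
  simp only [sum_load_inl, sum_load_inr, Finset.sum_add_distrib] at h1 h2 h3 h4 h5
  have ezx : ∀ w, I.load (Sum.inr w) x = I.load (Sum.inr w) z := fun w =>
    (Finset.sum_eq_sum_iff_of_le fun w _ => hzx w).1
      (by rw [sum_load_inr, sum_load_inr]; linarith) w (Finset.mem_univ w)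
  have ezy : ∀ w, I.load (Sum.inr w) y = I.load (Sum.inr w) z := fun w =>
    (Finset.sum_eq_sum_iff_of_le fun w _ => hzy w).1
      (by rw [sum_load_inr, sum_load_inr]; linarith) w (Finset.mem_univ w)
  have eux : ∀ f, I.load (Sum.inl f) x = I.load (Sum.inl f) u := fun f =>
    (Finset.sum_eq_sum_iff_of_le fun f _ => hux f).1
      (by rw [sum_load_inl, sum_load_inl]; linarith) f (Finset.mem_univ f)
  have euy : ∀ f, I.load (Sum.inl f) y = I.load (Sum.inl f) u := fun f =>
    (Finset.sum_eq_sum_iff_of_le fun f _ => huy f).1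
      (by rw [sum_load_inl, sum_load_inl]; linarith) f (Finset.mem_univ f)
  have esum : ∀ e, z e + u e = x e + y e := fun e =>
    (Finset.sum_eq_sum_iff_of_le fun e _ => hsum e).1
      (by simp only [Finset.sum_add_distrib]; linarith) e (Finset.mem_univ e)
  refine ⟨z, u, hz, hu, fun e => ?_, ?_, ?_, fun f => (eux f).symm⟩
  · have hM := hzJ e
    have hM' := huJ e
    have hs := esum e
    have hm := hmin e
    rcases le_total (x e) (y e) with h | h
    · rw [max_eq_right h] at hM hM'
      rw [min_eq_left h] at hm
      rcases hm with hm | hm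
      · left; linarith
      · right; linarith
    · rw [max_eq_left h] at hM hM'
      rw [min_eq_right h] at hm
      rcases hm with hm | hm
      · right; linarith
      · left; linarith
  · rintro (f | w)
    · rw [euy, eux]
    · rw [ezy, ezx]
  · rintro (f | w)
    · have : I.load (Sum.inl f) z + I.load (Sum.inl f) u
          = I.load (Sum.inl f) x + I.load (Sum.inl f) y := by
        simp only [load, ← Finset.sum_add_distrib]
        exact Finset.sum_congr rfl fun e _ => esum e
      linarith [eux f, euy f]
    · rw [ezx]

theorem Stable.load_eq [Fintype F] [Fintype W] {x y : I.E → ℝ} (hx : I.Stable x)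
    (hy : I.Stable y) (v : F ⊕ W) : I.load v y = I.load v x :=
  (hx.exists_join_meet hy).elim fun _ h => h.elim fun _ h => h.2.2.2.1 v

/-- A deficit vertex has the same assignment in all stable assignments. -/
theorem Stable.eq_of_deficit [Fintype F] [Fintype W] {x y : I.E → ℝ} (hx : I.Stable x)
    (hy : I.Stable y) {v : F ⊕ W} (hv : I.Deficit x v) : ∀ e ∈ I.star v, y e = x e := by
  obtain ⟨z, u, hz, hu, -, hl, hlz, hlu⟩ := hx.exists_join_meet hy
  have key : ∀ t, I.IsChoice v (x ⊔ y) t → I.load v t = I.load v x →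
      ∀ e ∈ I.star v, y e = x e := by
    intro t ht hlt e he
    -- Free quota means that nothing was cut, so `x ∨ y` has the same load at `v` as `x` and `y`,
    -- both of which it dominates.
    have hJ := load_congr (ht.eq_of_load_lt (hlt.trans_lt hv))
    rw [eqOn_of_le_of_load_le (v := v) (x := x) (y := x ⊔ y) (by rw [← hJ, hlt])
        (fun e _ => le_sup_left (a := x e)) e he,
      eqOn_of_le_of_load_le (v := v) (x := y) (y := x ⊔ y) (by rw [← hJ, hlt, hl])
        (fun e _ => le_sup_right (b := y e)) e he]
  rcases v with f | w
  · exact key u (hu f) (hlu f)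
  · exact key z (hz w) (hlz _)

/-- Suppose `e` blocks the workers' join `z`. The worker cut nothing from `e`, and by
`not_wants_of_eq` and stability the firm does not want `e` under `x` or `y`. An edge `c` that makes
the firm want `e` under `z` carries `x c` or `y c`, and contradicts one of these. -/
theorem exists_stable_preferred [Fintype F] [Fintype W] {x : I.E → ℝ} (hx : I.Stable x)
    (hmax : ¬ I.IsXMax x) : ∃ z, I.Stable z ∧ z ≠ x ∧
      ∀ w, ∀ c ∈ I.star (Sum.inr w), z c < x c → ¬ I.Wants (Sum.inr w) z c := by
  simp only [IsXMax, PrefersW, Prefers, not_and, not_forall] at hmax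
  obtain ⟨y, hy, w₀, e₀, he₀, hne⟩ := hmax hx
  obtain ⟨hxa, hxl, hxs⟩ := stable_iff.1 hx
  obtain ⟨hya, hyl, hys⟩ := stable_iff.1 hy
  obtain ⟨z, u, hz, hu, hzxy, hl, hlz, hlu⟩ := hx.exists_join_meet hy
  have hxJ : x ≤ x ⊔ y := le_sup_left
  have hyJ : y ≤ x ⊔ y := le_sup_right
  refine ⟨z, stable_iff.2 ⟨fun e => ?_, fun v => (hlz v).trans_le (hxl v), fun e hu hf hw => ?_⟩,
    ?_, fun w c hc hlt => (hz w).not_wants c hc (hlt.trans_le (hxJ c))⟩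
  · rcases hzxy e with h | h <;> rw [h]
    exacts [hxa e, hya e]
  · have hzw := hz e.1.2
    have hew := mem_star_worker e
    have hzJ : z e = (x ⊔ y) e :=
      (hzw.le e hew).antisymm (le_of_not_gt fun hlt => hzw.not_wants e hew hlt hw)
    have key : ∀ t : I.E → ℝ, I.Stable t → t ≤ x ⊔ y → I.load (I.worker e) t ≤ I.load (I.worker e) z →
        ¬ I.Wants (I.firm e) t e := by
      intro t ht htJ htl hwf
      obtain ⟨hta, -, hts⟩ := stable_iff.1 ht
      have hle : t e ≤ z e := hzJ ▸ htJ e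
      exact not_wants_of_eq hzw.nonneg hzw.load_le htl
        (fun c hc hlt => hzw.not_wants c hc (hlt.trans_le (htJ c))) hew
        (hts e (hle.trans_lt hu) hwf) hle hw
    have kx := key x hx hxJ (hlz _).ge
    have ky := key y hy hyJ (by rw [hlz, hl])
    have hef := mem_star_firm e
    have hkx := (not_wants_iff hef).1 kx
    have hky := (not_wants_iff hef).1 ky
    rcases hf with hf | ⟨c, hc, hc0, hec⟩
    · rw [hlz] at hf
      exact absurd hf (not_lt.2 hkx.1)
    · have fin : ∀ t : I.E → ℝ, t ≤ x ⊔ y → ¬ I.Wants (I.firm e) t e → z c = t c → False := by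
        intro t htJ hnt heq
        have h1 := ((not_wants_iff hef).1 hnt).2 c hc (heq ▸ hc0)
        rcases hec with hec | hec
        · exact hec.2 h1.1
        · have := h1.2 hec.1
          have h2 : t e ≤ z e := hzJ ▸ htJ e
          linarith [hec.2]
      exact (hzxy c).elim (fin x hxJ kx) (fin y hyJ ky)
  · rintro rfl
    exact hne ((isChoice_choice fun e _ => le_sup_of_le_left (hxa e).1).unique (hz w₀) e₀ he₀)

/-! ### Potential heads, regular vertices and active edges. -/

theorem Stable.nonneg {x : I.E → ℝ} (hx : I.Stable x) (e : I.E) : 0 ≤ x e := (hx.1.1 e).1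

theorem Stable.le_cap {x : I.E → ℝ} (hx : I.Stable x) (e : I.E) : x e ≤ I.b e := (hx.1.1 e).2

theorem Stable.load_le {x : I.E → ℝ} (hx : I.Stable x) (v : F ⊕ W) : I.load v x ≤ I.q v :=
  (stable_iff.1 hx).2.1 v

theorem Stable.not_wants_firm {x : I.E → ℝ} (hx : I.Stable x) {e : I.E} (hu : I.Unsaturated x e)
    (hw : I.Wants (I.worker e) x e) : ¬ I.Wants (I.firm e) x e :=
  fun hf => (stable_iff.1 hx).2.2 e hu hf hw

theorem Stable.fullyFilled {x : I.E → ℝ} (hx : I.Stable x) (h : ¬ I.Deficit x v) :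
    I.FullyFilled x v :=
  (hx.load_le v).antisymm (not_lt.1 h)

theorem mem_tieD {x : I.E → ℝ} (hx : I.Stable x) {f : F} {e a : I.E} :
    a ∈ I.tieD x f e ↔ a ∈ I.star (Sum.inl f) ∧
      (I.ge (Sum.inl f) a e ∧ I.ge (Sum.inl f) e a) ∧ I.Unsaturated x a ∧
        I.Wants (I.worker a) x a := by
  simp [tieD, mem_tail_iff (fun e _ => hx.nonneg e) (hx.load_le _), mem_star_worker]

theorem mem_potentialHead {x : I.E → ℝ} {f : F} {a : I.E} :
    a ∈ I.potentialHead x f ↔ a ∈ I.star (Sum.inl f) ∧ I.Candidate x f a ∧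
      (∀ c, I.Candidate x f c → I.ge (Sum.inl f) a c) ∧ a ∈ I.tieD x f a := by
  simp [potentialHead]

theorem candidate_of_wants {x : I.E → ℝ} (hx : I.Stable x) {f : F} {e : I.E}
    (he : e ∈ I.star (Sum.inl f)) (hu : I.Unsaturated x e) (hw : I.Wants (I.worker e) x e)
    (hd : ∀ a ∈ I.star (Sum.inl f), I.ge (Sum.inl f) a e → I.Unsaturated x a →
      ¬ I.Deficit x (I.worker a)) : I.Candidate x f e := by
  refine ⟨he, ⟨e, (mem_tieD hx).2 ⟨he, ⟨ge_refl_star he, ge_refl_star he⟩, hu, hw⟩⟩, ?_⟩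
  rintro ⟨a, ha, hae, hau, had⟩
  exact hd a ha hae hau had

theorem potentialHead_ge {x : I.E → ℝ} {f : F} {a c : I.E}
    (ha : a ∈ I.potentialHead x f) (hc : c ∈ I.potentialHead x f) : I.ge (Sum.inl f) a c :=
  (mem_potentialHead.1 ha).2.2.1 c (mem_potentialHead.1 hc).2.1

theorem potentialHead_wants {x : I.E → ℝ} (hx : I.Stable x) {f : F} {a : I.E}
    (ha : a ∈ I.potentialHead x f) : I.Unsaturated x a ∧ I.Wants (I.worker a) x a :=
  ((mem_tieD hx).1 (mem_potentialHead.1 ha).2.2.2).2.2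

theorem potentialHead_not_wants {x : I.E → ℝ} (hx : I.Stable x) {f : F} {a : I.E}
    (ha : a ∈ I.potentialHead x f) : ¬ I.Wants (Sum.inl f) x a := by
  obtain ⟨hu, hw⟩ := potentialHead_wants hx ha
  rw [mem_star_inl.1 (mem_potentialHead.1 ha).1]
  exact hx.not_wants_firm hu hw

theorem potentialHead_fullyFilled {x : I.E → ℝ} (hx : I.Stable x) {f : F} {a : I.E}
    (ha : a ∈ I.potentialHead x f) : I.FullyFilled x (I.worker a) := by
  obtain ⟨has, hc, -, -⟩ := mem_potentialHead.1 ha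
  exact hx.fullyFilled fun hd =>
    hc.2.2 ⟨a, has, ge_refl_star has, (potentialHead_wants hx ha).1, hd⟩

/-- The potential head lies in the best tie offering a desirable unsaturated edge. -/
theorem mem_potentialHead_of_ge {x : I.E → ℝ} (hx : I.Stable x) {f : F} {a e : I.E}
    (ha : a ∈ I.potentialHead x f) (he : e ∈ I.star (Sum.inl f)) (hu : I.Unsaturated x e)
    (hw : I.Wants (I.worker e) x e) (hge : I.ge (Sum.inl f) e a) : e ∈ I.potentialHead x f := by
  obtain ⟨has, hc, hbest, hD⟩ := mem_potentialHead.1 ha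
  have hce : I.Candidate x f e := candidate_of_wants hx he hu hw fun c hcs hge' hcu hcd =>
    hc.2.2 ⟨c, hcs, ge_trans_star hcs he has hge' hge, hcu, hcd⟩
  exact mem_potentialHead.2 ⟨he, hce,
    fun c hcc => ge_trans_star he has hcc.1 hge (hbest c hcc),
    (mem_tieD hx).2 ⟨he, ⟨ge_refl_star he, ge_refl_star he⟩, hu, hw⟩⟩

theorem exists_mem_potentialHead {x : I.E → ℝ} (hx : I.Stable x) {f : F} {e : I.E}
    (he : I.Candidate x f e) : ∃ a ∈ I.potentialHead x f, I.ge (Sum.inl f) a e := by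
  classical
  let s := (I.star (Sum.inl f)).filter fun c => I.Candidate x f c
  obtain ⟨k, hk, hbest⟩ := exists_best (s := s) (Finset.filter_subset _ _)
    ⟨e, Finset.mem_filter.2 ⟨he.1, he⟩⟩
  obtain ⟨hks, hkc⟩ := Finset.mem_filter.1 hk
  have hbest' : ∀ c, I.Candidate x f c → I.ge (Sum.inl f) k c := fun c hc =>
    hbest c (Finset.mem_filter.2 ⟨hc.1, hc⟩)
  obtain ⟨a, ha⟩ := hkc.2.1
  obtain ⟨has, ⟨hak, hka⟩, hau, haw⟩ := (mem_tieD hx).1 ha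
  refine ⟨a, mem_potentialHead.2 ⟨has, candidate_of_wants hx has hau haw ?_, fun c hc =>
    ge_trans_star has hks hc.1 hak (hbest' c hc),
    (mem_tieD hx).2 ⟨has, ⟨ge_refl_star has, ge_refl_star has⟩, hau, haw⟩⟩,
    ge_trans_star has hks he.1 hak (hbest' e he)⟩
  exact fun c hc hca hcu hcd => hkc.2.2 ⟨c, hc, ge_trans_star hc has hks hca hak, hcu, hcd⟩

theorem mem_head_worker_iff {x : I.E → ℝ} (hx : I.Stable x) {w : W}
    (hf : I.FullyFilled x (Sum.inr w)) {e : I.E} : e ∈ I.head x (Sum.inr w) ↔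
      e ∈ I.star (Sum.inr w) ∧ 0 < x e ∧ ¬ I.Wants (Sum.inr w) x e :=
  mem_head_iff (fun e _ => hx.nonneg e) hf

theorem head_nonempty {x : I.E → ℝ} (hx : I.Stable x) (hf : I.FullyFilled x v) :
    (I.head x v).Nonempty := by
  obtain ⟨-, -, c, hc, hcv⟩ := head_spec (fun e _ => hx.nonneg e) hf
  exact ⟨c, by rw [head, if_pos hf, Finset.mem_filter]; exact ⟨hc, hcv⟩⟩

theorem fullyFilled_of_mem_head {x : I.E → ℝ} {e : I.E} (he : e ∈ I.head x v) :
    I.FullyFilled x v := by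
  by_contra h
  simp [head, h] at he

theorem outSet_subset_star {x : I.E → ℝ} (hx : I.Stable x) : I.outSet x v ⊆ I.star v := by
  rcases v with f | w
  · exact fun a ha => (mem_potentialHead.1 ha).1
  · exact fun a ha => ((mem_head_worker_iff hx (fullyFilled_of_mem_head ha)).1 ha).1

theorem Regular.outSet_nonempty {x : I.E → ℝ} (hx : I.Stable x) (hv : I.Regular x v) :
    (I.outSet x v).Nonempty := by
  rcases v with f | w
  · rw [Finset.nonempty_iff_ne_empty]
    exact fun h => hv.2 (Singular.empty f hv.1 h)
  · exact head_nonempty hx hv.1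

/-- The end of `e` other than `v`, for `e ∈ E_v`. -/
def otherEnd (I : SMP F W) : F ⊕ W → I.E → F ⊕ W
  | Sum.inl _, e => I.worker e
  | Sum.inr _, e => I.firm e

theorem isEnd_otherEnd (e : I.E) : IsEnd (I.otherEnd v e) e.1 := by
  rcases v with f | w
  · exact Or.inr rfl
  · exact Or.inl rfl

theorem otherEnd_ne (e : I.E) : v ≠ I.otherEnd v e := by
  rcases v with f | w <;> simp [otherEnd, firm, worker]

/-- The other end is full, because `D_f` avoids deficit workers and a head meeting a deficit firm
would make its worker singular; it is nonsingular, because singularity spreads backwards along arcs.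
-/
theorem ActiveAt.regular_otherEnd {x : I.E → ℝ} (hx : I.Stable x) {e : I.E}
    (h : I.ActiveAt x v e) : I.Regular x (I.otherEnd v e) := by
  refine ⟨?_, fun hs => h.1.2 (Singular.step v _ e h.1.1 h.2 (isEnd_otherEnd e) hs)⟩
  rcases v with f | w
  · exact potentialHead_fullyFilled hx h.2
  · exact hx.fullyFilled fun hd => h.1.2 (Singular.deficit w e h.1.1 h.2 hd)

theorem activeEdges_nonempty_iff {x : I.E → ℝ} (hx : I.Stable x) :
    (I.activeEdges x).Nonempty ↔ ∃ v, I.Regular x v := by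
  constructor
  · rintro ⟨e, v, hv, -⟩
    exact ⟨v, hv⟩
  · rintro ⟨v, hv⟩
    obtain ⟨e, he⟩ := hv.outSet_nonempty hx
    exact ⟨e, v, hv, he⟩

/-! ### From a preferred stable assignment to regular vertices. -/

/-- If the workers prefer some other stable assignment, then there are regular vertices: all the
vertices at which the two assignments differ. -/
theorem exists_regular_of_preferred [Fintype F] [Fintype W] {x y : I.E → ℝ} (hx : I.Stable x)
    (hy : I.Stable y) (hne : y ≠ x)
    (hpref : ∀ w, ∀ c ∈ I.star (Sum.inr w), y c < x c → ¬ I.Wants (Sum.inr w) y c) :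
    ∃ v, I.Regular x v := by
  have hload : ∀ v, I.load v y = I.load v x := hx.load_eq hy
  have hdef : ∀ {v}, I.Deficit x v → ∀ e ∈ I.star v, y e = x e := hx.eq_of_deficit hy
  have hwants : ∀ e, x e < y e → I.Unsaturated x e ∧ I.Wants (I.worker e) x e := by
    intro e he
    refine ⟨he.trans_le (hy.le_cap e), ?_⟩
    by_contra hw
    exact absurd (le_of_not_wants (fun e _ => hx.nonneg e) (fun e _ => hy.nonneg e)
      (hy.load_le _) (hpref e.1.2) (mem_star_worker e) hw) (not_le.2 he)
  have hraise : ∀ v, (∃ e ∈ I.star v, y e ≠ x e) → ∃ e ∈ I.star v, x e < y e := by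
    rintro v ⟨e, he, hne⟩
    rcases lt_or_gt_of_ne hne with h | h
    · exact exists_lt_of_load_le (hload v).ge he h
    · exact ⟨e, he, h⟩
  -- The firm does not want the raised edge `e` under `x`. Were `a` at least as good as `e`, they
  -- would be tied and `x a ≤ x e < y e ≤ y a = x a`.
  have htie : ∀ f, ∀ a ∈ I.star (Sum.inl f), ∀ e ∈ I.star (Sum.inl f), x e < y e → y a = x a →
      ¬ I.Wants (Sum.inl f) x a → ¬ I.Wants (Sum.inl f) y a → ¬ I.ge (Sum.inl f) a e := by
    intro f a ha e he hlt heq hxa hya hae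
    have hnf : ¬ I.Wants (Sum.inl f) x e := by
      obtain ⟨hu, hw⟩ := hwants e hlt
      rw [mem_star_inl.1 he]
      exact hx.not_wants_firm hu hw
    have h1 := ((not_wants_iff ha).1 hya).2 e he ((hx.nonneg e).trans_lt hlt)
    have h2 := h1.2 hae
    have h3 : x a ≤ x e := by
      rcases (hx.nonneg a).lt_or_eq with h0 | h0
      · exact (((not_wants_iff he).1 hnf).2 a ha h0).2 h1.1
      · exact h0 ▸ hx.nonneg e
    linarith
  -- For a vertex where `y` and `x` differ, the first conjunct excludes the base rules of
  -- `Singular`, and the second passes the difference along the out-set, which serves the inductive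
  -- rule.
  have hstep : ∀ v, (∃ e ∈ I.star v, y e ≠ x e) → (v.elim (fun f => (I.potentialHead x f).Nonempty)
      fun w => ∀ e ∈ I.head x (Sum.inr w), ¬ I.Deficit x (I.firm e)) ∧
      ∀ e ∈ I.outSet x v, ∀ u, IsEnd u e.1 → ∃ a ∈ I.star u, y a ≠ x a := by
    rintro v hv
    have hred : ∀ e ∈ I.star v, (∃ a ∈ I.star (I.otherEnd v e), y a ≠ x a) →
        ∀ u, IsEnd u e.1 → ∃ a ∈ I.star u, y a ≠ x a := by
      intro e he h u hu
      rcases v with f | w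
      · rcases hu with rfl | rfl
        · rwa [mem_star_inl.1 he] at hv
        · exact h
      · rcases hu with rfl | rfl
        · exact h
        · rwa [mem_star_inr.1 he] at hv
    obtain ⟨e, he, hlt⟩ := hraise v hv
    obtain ⟨hu, hw⟩ := hwants e hlt
    rcases v with f | w
    · have hcand : I.Candidate x f e := candidate_of_wants hx he hu hw fun a ha hae hau had => by
        have heq := hdef had a (mem_star_worker a)
        have hau' : I.Unsaturated y a := by rw [Unsaturated, heq]; exact hau
        have hxa := hx.not_wants_firm hau (Or.inl had)
        have hya := hy.not_wants_firm hau' (Or.inl ((hload _).trans_lt had))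
        rw [firm, ← mem_star_inl.1 ha] at hxa hya
        exact htie f a ha e he hlt heq hxa hya hae
      obtain ⟨a, ha, hae⟩ := exists_mem_potentialHead hx hcand
      refine ⟨⟨a, ha⟩, fun c hc => hred c (outSet_subset_star hx hc) ?_⟩
      -- If nothing changes at the worker of `c`, the worker still wants the unsaturated `c` under
      -- `y`, so the firm does not; `htie` then rules out a raised edge no better than `c`.
      by_contra hcon
      push Not at hcon
      have hcs := outSet_subset_star hx hc
      obtain ⟨hcu, hcw⟩ := potentialHead_wants hx hc
      have heq := hcon c (mem_star_worker c)
      have hyc := hy.not_wants_firm (e := c) (by rw [Unsaturated, heq]; exact hcu)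
        (hcw.congr (fun a ha => (hcon a ha).symm) (mem_star_worker c))
      rw [firm, ← mem_star_inl.1 hcs] at hyc
      refine htie f c hcs e he hlt heq (potentialHead_not_wants hx hc) hyc ?_
      exact ge_trans_star hcs (outSet_subset_star hx ha) he (potentialHead_ge hc ha) hae
    -- Some edge `d` at `w` drops, since another rises. An unchanged head edge `c` would give `y c ≤
    -- y d < x d ≤ x c`.
    · have main : ∀ c ∈ I.head x (Sum.inr w), y c ≠ x c := by
        intro c hc heq
        obtain ⟨hcs, hc0, hcw⟩ := (mem_head_worker_iff hx (fullyFilled_of_mem_head hc)).1 hc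
        obtain ⟨d, hd, hdlt⟩ := exists_lt_of_load_le (hload (Sum.inr w)).le he hlt
        have h1 := ((not_wants_iff hd).1 (hpref w d hd hdlt)).2 c hcs (heq ▸ hc0)
        have h2 := ((not_wants_iff hcs).1 hcw).2 d hd ((hy.nonneg d).trans_lt hdlt)
        linarith [h1.2 h2.1, h2.2 h1.1]
      refine ⟨fun c hc hd => main c hc (hdef hd c (mem_star_firm c)), fun c hc =>
        hred c (outSet_subset_star hx hc) ⟨c, mem_star_firm c, main c hc⟩⟩
  have hns : ∀ v, I.Singular x v → ¬ ∃ e ∈ I.star v, y e ≠ x e := by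
    intro v hs
    induction hs with
    | deficit w e hw he hd => exact fun h => (hstep _ h).1 e he hd
    | empty f hf hD => exact fun h => by simpa [hD] using (hstep _ h).1
    | step v u e hv he hu hs ih => exact fun h => ih ((hstep v h).2 e he u hu)
  obtain ⟨e, he⟩ := Function.ne_iff.1 hne
  have hex : ∃ a ∈ I.star (I.firm e), y a ≠ x a := ⟨e, mem_star_firm e, he⟩
  refine ⟨I.firm e, hx.fullyFilled fun hd => he (hdef hd e (mem_star_firm e)),
    fun hs => hns _ hs hex⟩

/-! ### Moving a stable assignment along a solution of the linear system. -/

/-- Edges of `D_f` are wanted by their workers and head edges are not, so no edge is both raised and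
lowered by `shift`. -/
theorem ActiveAt.not_worker {x : I.E → ℝ} (hx : I.Stable x) {e : I.E}
    (h : I.ActiveAt x (I.firm e) e) : ¬ I.ActiveAt x (I.worker e) e := fun h' =>
  ((mem_head_worker_iff hx h'.1.1).1 h'.2).2.2 (potentialHead_wants hx h.2).2

open Classical in
/-- The direction in which `x` is moved along a solution of the linear system. -/
noncomputable def shift (I : SMP F W) (x : I.E → ℝ) (φ : F → ℝ) (ψ : W → ℝ) (e : I.E) : ℝ :=
  (if I.ActiveAt x (I.firm e) e then φ e.1.1 else 0) -
    (if I.ActiveAt x (I.worker e) e then ψ e.1.2 else 0)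

section Shift

variable {x : I.E → ℝ} {ε : ℝ} {φ : F → ℝ} {ψ : W → ℝ}

theorem shift_of_firm (hx : I.Stable x) {e : I.E} (h : I.ActiveAt x (I.firm e) e) :
    I.shift x φ ψ e = φ e.1.1 := by
  simp [shift, h, h.not_worker hx]

theorem shift_of_worker (hx : I.Stable x) {e : I.E} (h : I.ActiveAt x (I.worker e) e) :
    I.shift x φ ψ e = -ψ e.1.2 := by
  have : ¬ I.ActiveAt x (I.firm e) e := fun h' => h'.not_worker hx h
  simp [shift, h, this]

theorem not_activeAt_of_not_regular (hx : I.Stable x) {e : I.E} (he : e ∈ I.star v)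
    (hv : ¬ I.Regular x v) : ¬ I.ActiveAt x (I.firm e) e ∧ ¬ I.ActiveAt x (I.worker e) e := by
  rcases v with f | w
  · rw [mem_star_inl.1 he] at hv
    exact ⟨fun h => hv h.1, fun h => hv (h.regular_otherEnd hx)⟩
  · rw [mem_star_inr.1 he] at hv
    exact ⟨fun h => hv (h.regular_otherEnd hx), fun h => hv h.1⟩

variable [Fintype F] [Fintype W]

theorem shift_nonpos (hx : I.Stable x) (hlp : I.IsLPSolution x ε φ ψ) {e : I.E}
    (h : ¬ I.ActiveAt x (I.firm e) e) : I.shift x φ ψ e ≤ 0 := by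
  by_cases h' : I.ActiveAt x (I.worker e) e
  · rw [shift_of_worker hx h']
    linarith [hlp.lp4_psi _ h'.1]
  · simp [shift, h, h']

theorem activeAt_of_shift_neg (hlp : I.IsLPSolution x ε φ ψ) {e : I.E}
    (h : I.shift x φ ψ e < 0) : I.ActiveAt x (I.worker e) e := by
  by_contra h'
  by_cases h'' : I.ActiveAt x (I.firm e) e
  · have := hlp.lp4_phi _ h''.1
    simp [shift, h', h''] at h
    linarith
  · simp [shift, h', h''] at h

theorem activeAt_of_shift_pos (hx : I.Stable x) (hlp : I.IsLPSolution x ε φ ψ) {e : I.E}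
    (h : 0 < I.shift x φ ψ e) : I.ActiveAt x (I.firm e) e := by
  by_contra h'
  exact absurd h (not_lt.2 (shift_nonpos hx hlp h'))

/-- At regular vertices this is what the equations `lp1` and `lp2` say; other vertices meet no
active edge. -/
theorem load_shift (hx : I.Stable x) (hlp : I.IsLPSolution x ε φ ψ) (v : F ⊕ W) :
    I.load v (I.shift x φ ψ) = 0 := by
  classical
  by_cases hv : I.Regular x v
  swap
  · refine Finset.sum_eq_zero fun e he => ?_
    obtain ⟨h1, h2⟩ := not_activeAt_of_not_regular hx he hv
    simp [shift, h1, h2]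
  unfold load shift
  rw [Finset.sum_sub_distrib, ← Finset.sum_filter, ← Finset.sum_filter]
  rcases v with f | w
  · have h1 : (I.star (Sum.inl f)).filter (fun e => I.ActiveAt x (I.firm e) e)
        = I.potentialHead x f := by
      ext e
      rw [Finset.mem_filter]
      constructor
      · rintro ⟨he, h⟩
        rw [mem_star_inl.1 he]
        exact h.2
      · intro he
        have hes := outSet_subset_star (v := Sum.inl f) hx he
        refine ⟨hes, ?_⟩
        rw [firm, ← mem_star_inl.1 hes]
        exact ⟨hv, he⟩
    have h2 : ∑ e ∈ I.potentialHead x f, φ e.1.1 = ((I.potentialHead x f).card : ℝ) * φ f := by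
      rw [← nsmul_eq_mul, ← Finset.sum_const]
      refine Finset.sum_congr rfl fun e he => ?_
      rw [← mem_star_inl.1 (outSet_subset_star (v := Sum.inl f) hx he)]
    rw [h1, h2]
    exact hlp.lp1 f hv
  · have h1 : (I.star (Sum.inr w)).filter (fun e => I.ActiveAt x (I.worker e) e)
        = I.head x (Sum.inr w) := by
      ext e
      rw [Finset.mem_filter]
      constructor
      · rintro ⟨he, h⟩
        rw [mem_star_inr.1 he]
        exact h.2
      · intro he
        have hes := outSet_subset_star (v := Sum.inr w) hx he
        refine ⟨hes, ?_⟩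
        rw [worker, ← mem_star_inr.1 hes]
        exact ⟨hv, he⟩
    have h2 : ∑ e ∈ I.head x (Sum.inr w), ψ e.1.2 =
        ((I.head x (Sum.inr w)).card : ℝ) * ψ w := by
      rw [← nsmul_eq_mul, ← Finset.sum_const]
      refine Finset.sum_congr rfl fun e he => ?_
      rw [← mem_star_inr.1 (outSet_subset_star (v := Sum.inr w) hx he)]
    rw [h1, h2]
    linarith [hlp.lp2 w hv]

theorem exists_phi_pos (hlp : I.IsLPSolution x ε φ ψ) (hε : 0 < ε) :
    ∃ f, I.Regular x (Sum.inl f) ∧ 0 < φ f := by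
  classical
  by_contra hcon
  push Not at hcon
  have h3 := hlp.lp3
  have h1 : ∑ f with I.Regular x (Sum.inl f), ((I.potentialHead x f).card : ℝ) * φ f ≤ 0 :=
    Finset.sum_nonpos fun f hf =>
      mul_nonpos_of_nonneg_of_nonpos (Nat.cast_nonneg _) (hcon f (Finset.mem_filter.1 hf).2)
  have h2 : ∑ w with I.Regular x (Sum.inr w),
      ((I.head x (Sum.inr w)).card : ℝ) * ψ w ≤ 0 := by
    refine Finset.sum_nonpos fun w hw => ?_
    rw [sub_eq_zero.1 (hlp.lp2 w (Finset.mem_filter.1 hw).2)]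
    exact Finset.sum_nonpos fun e he => hcon _ (Finset.mem_filter.1 he).2.1
  linarith

open Filter Topology in
-- Lowered edges are positive and raised edges unsaturated, so only finitely many strict
-- inequalities must survive, and they do for all small `t > 0`.
theorem exists_small_step (hx : I.Stable x) (hlp : I.IsLPSolution x ε φ ψ) :
    ∃ t : ℝ, 0 < t ∧ I.Admissible (fun e => x e + t * I.shift x φ ψ e) ∧
      ∀ a c, x a < x c → x a + t * I.shift x φ ψ a < x c + t * I.shift x φ ψ c := by
  set δ := I.shift x φ ψ
  have hlt : ∀ p p' d d' : ℝ, p < p' → ∀ᶠ t in 𝓝[>] (0 : ℝ), p + t * d < p' + t * d' := by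
    intro p p' d d' h
    refine eventually_nhdsWithin_of_eventually_nhds ?_
    have h1 : Tendsto (fun t : ℝ => p + t * d) (𝓝 0) (𝓝 (p + 0 * d)) :=
      Continuous.tendsto (by fun_prop) 0
    have h2 : Tendsto (fun t : ℝ => p' + t * d') (𝓝 0) (𝓝 (p' + 0 * d')) :=
      Continuous.tendsto (by fun_prop) 0
    exact h1.eventually_lt h2 (by simpa using h)
  have hpos : ∀ᶠ t in 𝓝[>] (0 : ℝ), 0 < t := eventually_mem_nhdsWithin
  have hA : ∀ e, ∀ᶠ t in 𝓝[>] (0 : ℝ), 0 ≤ x e + t * δ e ∧ x e + t * δ e ≤ I.b e := by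
    intro e
    rcases lt_trichotomy (δ e) 0 with h | h | h
    · have hact := activeAt_of_shift_neg hlp h
      have h0 := ((mem_head_worker_iff hx hact.1.1).1 hact.2).2.1
      filter_upwards [hlt 0 (x e) 0 (δ e) h0, hpos] with t ht ht0
      refine ⟨by linarith, ?_⟩
      have := mul_neg_of_pos_of_neg ht0 h
      linarith [hx.le_cap e]
    · exact Eventually.of_forall fun t => by simpa [h] using hx.1.1 e
    · have hact := activeAt_of_shift_pos hx hlp h
      have h0 : x e < I.b e := (potentialHead_wants hx hact.2).1
      filter_upwards [hlt (x e) (I.b e) (δ e) 0 h0, hpos] with t ht ht0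
      have := mul_pos ht0 h
      exact ⟨by linarith [hx.nonneg e], by linarith⟩
  have hO : ∀ᶠ t in 𝓝[>] (0 : ℝ), ∀ a c, x a < x c → x a + t * δ a < x c + t * δ c := by
    rw [eventually_all]
    intro a
    rw [eventually_all]
    intro c
    by_cases h : x a < x c
    · filter_upwards [hlt _ _ (δ a) (δ c) h] with t ht _ using ht
    · exact Eventually.of_forall fun _ h' => absurd h' h
  obtain ⟨t, h1, h2, h3⟩ := (hpos.and ((eventually_all.2 hA).and hO)).exists
  exact ⟨t, h1, h2, h3⟩

/-- Suppose `c` makes `e` newly wanted. If `c` is active from its firm, it was wanted under `x`, and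
what made it wanted gives `x c < x e` within one tie, an order that the step preserves. Otherwise
`c` did not rise, and it was level with `e`; then `e` dropped, both are head edges of `w`, and both
drop by the same `t * ψ w`. -/
theorem wants_worker_of_shift (hx : I.Stable x) (hlp : I.IsLPSolution x ε φ ψ) {t : ℝ}
    (ht : 0 < t) {x' : I.E → ℝ} (hx' : ∀ e, x' e = x e + t * I.shift x φ ψ e)
    (hl : ∀ v, I.load v x' = I.load v x) (hO : ∀ a c, x a < x c → x' a < x' c) {w : W} {e : I.E}
    (he : e ∈ I.star (Sum.inr w)) (hw : I.Wants (Sum.inr w) x' e) : I.Wants (Sum.inr w) x e := by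
  by_contra hn
  obtain ⟨hq, hne⟩ := (not_wants_iff he).1 hn
  rcases hw with hw | ⟨c, hc, hc0, hec⟩
  · rw [hl] at hw
    exact absurd hw (not_lt.2 hq)
  have hwe : I.worker e = Sum.inr w := by rw [worker, ← mem_star_inr.1 he]
  have hwc : I.worker c = Sum.inr w := by rw [worker, ← mem_star_inr.1 hc]
  by_cases hact : I.ActiveAt x (I.firm c) c
  · have hcw := (potentialHead_wants hx hact.2).2
    rw [hwc] at hcw
    rcases hcw with hcw | ⟨d, hd, hd0, hcd⟩
    · exact absurd hcw (not_lt.2 hq)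
    have hde := hne d hd hd0
    have hcd' : I.ge (Sum.inr w) c d := hcd.elim (fun h => h.1) fun h => h.1
    have hce := ge_trans_star hc hd he hcd' hde.1
    rcases hec with hec | hec
    · exact hec.2 hce
    rcases hcd with hcd | hcd
    · exact hcd.2 (ge_trans_star hd he hc hde.1 hec.1)
    · have := hde.2 (ge_trans_star he hc hd hec.1 hcd.1)
      linarith [hO c e (by linarith [hcd.2]), hec.2]
  · have hδ := mul_nonpos_of_nonneg_of_nonpos ht.le (shift_nonpos hx hlp hact)
    have hxc := hx' c
    have hxe := hx' e
    have hc0' : 0 < x c := by linarith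
    have hce := hne c hc hc0'
    rcases hec with hec | hec
    · exact hec.2 hce.1
    have h1 := hce.2 hec.1
    have h2 : x c = x e := by
      by_contra hne'
      linarith [hO c e (lt_of_le_of_ne h1 hne'), hec.2]
    have hneg : I.shift x φ ψ e < 0 := by
      have : t * I.shift x φ ψ e < 0 := by linarith [hec.2]
      by_contra h
      push Not at h
      linarith [mul_nonneg ht.le h]
    have hae := activeAt_of_shift_neg hlp hneg
    have hac : I.ActiveAt x (I.worker c) c := by
      rw [hwc]
      rw [hwe] at hae
      refine ⟨hae.1, (mem_head_worker_iff hx hae.1.1).2 ⟨hc, hc0', ?_⟩⟩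
      refine (not_wants_iff hc).2 ⟨hq, fun d hd hd0 => ?_⟩
      have hde := hne d hd hd0
      exact ⟨ge_trans_star hd he hc hde.1 hec.1,
        fun h => h2 ▸ hde.2 (ge_trans_star he hc hd hec.1 h)⟩
    rw [shift_of_worker hx hac, ← mem_star_inr.1 hc] at hxc
    rw [shift_of_worker hx hae, ← mem_star_inr.1 he] at hxe
    linarith [hec.2]

/-- Either nothing moves at the firm, or `D_f` rises uniformly while the other edges do not rise, so
`D_f` stays unwanted. An unsaturated edge wanted by its worker lies in `D_f` or in a worse tie. -/
theorem not_wants_firm_of_shift (hx : I.Stable x) (hlp : I.IsLPSolution x ε φ ψ) {t : ℝ}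
    (ht : 0 < t) {x' : I.E → ℝ} (hx' : ∀ e, x' e = x e + t * I.shift x φ ψ e)
    (hl : ∀ v, I.load v x' = I.load v x) {e : I.E} (hu : I.Unsaturated x e)
    (hw : I.Wants (I.worker e) x e) : ¬ I.Wants (I.firm e) x' e := by
  have hnf := hx.not_wants_firm hu hw
  obtain ⟨f, hf⟩ : ∃ f, I.firm e = Sum.inl f := ⟨_, rfl⟩
  have he := mem_star_firm e
  rw [hf] at he hnf ⊢
  have hzero : (∀ c ∈ I.star (Sum.inl f), I.shift x φ ψ c = 0) → ¬ I.Wants (Sum.inl f) x' e :=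
    fun h hw' => hnf (hw'.congr (fun c hc => by simp [hx', h c hc]) he)
  by_cases hreg : I.Regular x (Sum.inl f)
  swap
  · refine hzero fun c hc => ?_
    obtain ⟨h1, h2⟩ := not_activeAt_of_not_regular hx hc hreg
    simp [shift, h1, h2]
  have hfirm : ∀ c ∈ I.star (Sum.inl f), I.firm c = Sum.inl f := fun c hc => by
    rw [firm, ← mem_star_inl.1 hc]
  have hin : ∀ c ∈ I.potentialHead x f, I.shift x φ ψ c = φ f := fun c hc => by
    have hcs := outSet_subset_star (v := Sum.inl f) hx hc
    rw [shift_of_firm hx (by rw [hfirm c hcs]; exact ⟨hreg, hc⟩), ← mem_star_inl.1 hcs]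
  have hout : ∀ c ∈ I.star (Sum.inl f), c ∉ I.potentialHead x f → I.shift x φ ψ c ≤ 0 :=
    fun c hcs hc => shift_nonpos hx hlp fun h => hc (by rw [hfirm c hcs] at h; exact h.2)
  rcases (hlp.lp4_phi f hreg).lt_or_eq with hpos | h0
  swap
  -- With `φ f = 0` all shifts at the firm are nonpositive and sum to zero, so they vanish.
  · have hle : ∀ c ∈ I.star (Sum.inl f), I.shift x φ ψ c ≤ 0 := fun c hc => by
      by_cases h : c ∈ I.potentialHead x f
      · rw [hin c h, ← h0]
      · exact hout c hc h
    exact hzero ((Finset.sum_eq_zero_iff_of_nonpos hle).1 (load_shift hx hlp _))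
  have key : ∀ a ∈ I.potentialHead x f, ¬ I.Wants (Sum.inl f) x' a := by
    intro a ha
    have has := outSet_subset_star (v := Sum.inl f) hx ha
    obtain ⟨hq, hna⟩ := (not_wants_iff has).1 (potentialHead_not_wants hx ha)
    have hxa := hx' a
    rw [hin a ha] at hxa
    have htφ := mul_pos ht hpos
    refine (not_wants_iff has).2 ⟨(hl _).symm ▸ hq, fun c hc hc0 => ?_⟩
    have hxc := hx' c
    by_cases hcD : c ∈ I.potentialHead x f
    · rw [hin c hcD] at hxc
      refine ⟨potentialHead_ge hcD ha, fun hac => ?_⟩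
      rcases (hx.nonneg c).lt_or_eq with h | h
      · linarith [(hna c hc h).2 hac]
      · linarith [hx.nonneg a]
    · have hδ := mul_nonpos_of_nonneg_of_nonpos ht.le (hout c hc hcD)
      have := hna c hc (by linarith)
      exact ⟨this.1, fun h => by linarith [this.2 h]⟩
  obtain ⟨a, ha⟩ := hreg.outSet_nonempty hx
  have has := outSet_subset_star hx ha
  by_cases hea : I.ge (Sum.inl f) e a
  · exact key e (mem_potentialHead_of_ge hx ha he hu hw hea)
  · obtain ⟨hq, hna⟩ := (not_wants_iff has).1 (key a ha)
    refine (not_wants_iff he).2 ⟨hq, fun c hc hc0 => ?_⟩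
    have hca := (hna c hc hc0).1
    exact ⟨ge_trans_star hc has he hca (ge_of_not_ge he has hea),
      fun h => absurd (ge_trans_star he hc has h hca) hea⟩

theorem not_isXMax_of_isLPSolution (hx : I.Stable x) (hlp : I.IsLPSolution x ε φ ψ)
    (hε : 0 < ε) : ¬ I.IsXMax x := by
  obtain ⟨t, ht, hadm, hO⟩ := exists_small_step hx hlp
  obtain ⟨x', hx'⟩ : ∃ x' : I.E → ℝ, ∀ e, x' e = x e + t * I.shift x φ ψ e := ⟨_, fun _ => rfl⟩
  have hadm' : I.Admissible x' := fun e => by rw [hx']; exact hadm e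
  have hO' : ∀ a c, x a < x c → x' a < x' c := fun a c h => by rw [hx', hx']; exact hO a c h
  have hl : ∀ v, I.load v x' = I.load v x := fun v => by
    have h0 := load_shift hx hlp v
    simp only [load] at h0 ⊢
    simp only [hx', Finset.sum_add_distrib, ← Finset.mul_sum, h0, mul_zero, add_zero]
  have hst : I.Stable x' := by
    refine stable_iff.2 ⟨hadm', fun v => (hl v).trans_le (hx.load_le v), fun e hu hf hw => ?_⟩
    have hwx := wants_worker_of_shift hx hlp ht hx' hl hO' (mem_star_worker e) hw
    refine not_wants_firm_of_shift hx hlp ht hx' hl ?_ hwx hf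
    -- An edge that becomes unsaturated was lowered, so it is a head edge of its worker and was not
    -- wanted there.
    by_contra hs
    simp only [Unsaturated, not_lt] at hs hu
    have hneg : I.shift x φ ψ e < 0 := by
      rw [hx'] at hu
      by_contra h
      push Not at h
      linarith [mul_nonneg ht.le h]
    have hact := activeAt_of_shift_neg hlp hneg
    exact ((mem_head_worker_iff hx hact.1.1).1 hact.2).2.2 hwx
  rintro ⟨-, hmax⟩
  obtain ⟨f, hreg, hpos⟩ := exists_phi_pos hlp hε
  obtain ⟨a, ha⟩ := hreg.outSet_nonempty hx
  have has := mem_star_inl.1 (outSet_subset_star hx ha)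
  have hch := (isChoice_choice (v := I.worker a) (z := x ⊔ x')
    fun e _ => le_sup_of_le_left (hx.nonneg e)).congr (hmax x' hst a.1.2)
  -- If `x` were maximal, the worker would choose `x` from `x ∨ x'`, cutting the raised edge `a`
  -- that it wants under `x`.
  refine hch.not_wants a (mem_star_worker a) (lt_of_lt_of_le ?_ (le_sup_right (b := x' a)))
    (potentialHead_wants hx ha).2
  rw [hx', shift_of_firm hx (by rw [firm, ← has]; exact ⟨hreg, ha⟩), ← has]
  linarith [mul_pos ht hpos]

end Shift

end SMP

/-! ### Stationary distributions and strong components. -/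

/-- A nonnegative matrix whose row sums over `s` are `1` has a stationary distribution on `s`. -/
theorem Finset.exists_stationary {n : Type*} [Fintype n] (s : Finset n) (hs : s.Nonempty)
    (P : n → n → ℝ) (h0 : ∀ i j, 0 ≤ P i j) (h1 : ∀ i ∈ s, ∑ j ∈ s, P i j = 1) :
    ∃ p : n → ℝ, (∀ i, 0 ≤ p i) ∧ ∑ i ∈ s, p i = 1 ∧
      ∀ j ∈ s, ∑ i ∈ s, p i * P i j = p j := by
  classical
  -- The all-ones vector is a right null vector, so `M` is singular and has a left null vector `u`.
  let M : Matrix s s ℝ := Matrix.of (fun i j : s => P i j) - 1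
  have hM : M.det = 0 := by
    rw [← Matrix.exists_mulVec_eq_zero_iff]
    refine ⟨fun _ => 1, fun h => ?_, ?_⟩
    · obtain ⟨i, hi⟩ := hs
      exact one_ne_zero (congrFun h ⟨i, hi⟩)
    · funext i
      have := h1 i i.2
      rw [← Finset.sum_coe_sort, Finset.univ_eq_attach] at this
      simp [M, Matrix.mulVec, dotProduct, this, Matrix.one_apply]
  obtain ⟨u, hu, huM⟩ := Matrix.exists_vecMul_eq_zero_iff.2 hM
  have hst : ∀ j : s, ∑ i : s, u i * P i j = u j := by
    intro j
    have := congrFun huM j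
    simp only [M, Matrix.vecMul_sub, Matrix.vecMul_one, Pi.sub_apply, Pi.zero_apply,
      sub_eq_zero] at this
    exact this
  have hle : ∀ j : s, |u j| ≤ ∑ i : s, |u i| * P i j := by
    intro j
    rw [← hst j]
    refine (Finset.abs_sum_le_sum_abs _ _).trans_eq (Finset.sum_congr rfl fun i _ => ?_)
    rw [abs_mul, abs_of_nonneg (h0 _ _)]
  have htot : ∑ j : s, ∑ i : s, |u i| * P i j = ∑ j : s, |u j| := by
    rw [Finset.sum_comm]
    refine Finset.sum_congr rfl fun i _ => ?_
    rw [← Finset.mul_sum, Finset.sum_coe_sort s (fun j => P i j), h1 i i.2, mul_one]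
  -- The triangle inequality holds entrywise and both sides have the same total, so `|u|` is
  -- stationary too.
  have heq : ∀ j : s, |u j| = ∑ i : s, |u i| * P i j := fun j =>
    (Finset.sum_eq_sum_iff_of_le fun j _ => hle j).1 htot.symm j (Finset.mem_univ j)
  have hpos : 0 < ∑ j : s, |u j| := by
    obtain ⟨j, hj⟩ := Function.ne_iff.1 hu
    exact Finset.sum_pos' (fun _ _ => abs_nonneg _) ⟨j, Finset.mem_univ j, abs_pos.2 hj⟩
  set S := ∑ j : s, |u j|
  let p : n → ℝ := fun i => if h : i ∈ s then |u ⟨i, h⟩| / S else 0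
  have hp : ∀ i : s, p i = |u i| / S := fun i => by simp [p]
  refine ⟨p, fun i => ?_, ?_, fun j hj => ?_⟩
  · by_cases h : i ∈ s
    · simpa [p, h] using div_nonneg (abs_nonneg _) hpos.le
    · simp [p, h]
  · rw [← Finset.sum_coe_sort]
    simp only [hp]
    rw [← Finset.sum_div, div_self hpos.ne']
  · rw [← Finset.sum_coe_sort s (fun i => p i * P i j), hp ⟨j, hj⟩, heq ⟨j, hj⟩, Finset.sum_div]
    exact Finset.sum_congr rfl fun i _ => by rw [hp]; ring

/-- A finite loopless digraph has a strong component if some nonempty set of its vertices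
allows no dead ends. -/
theorem Digraph.exists_isStrongComponent {V : Type*} [Finite V] (D : Digraph V) {R : Set V}
    (hR : R.Nonempty) (hout : ∀ u ∈ R, ∃ v ∈ R, D.Adj u v) (hloop : ∀ u, ¬ D.Adj u u) :
    ∃ S, D.IsStrongComponent S := by
  suffices h : ∃ S : Set V, S.Nontrivial ∧ D.StronglyConnectedOn S by
    obtain ⟨S, hS⟩ := h
    obtain ⟨T, -, hT⟩ := Set.Finite.exists_le_maximal
      (Set.toFinite {T : Set V | T.Nontrivial ∧ D.StronglyConnectedOn T}) hS
    exact ⟨T, hT⟩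
  -- Iterating a successor map on a finite set reaches a periodic orbit, which is a directed cycle.
  choose g hgR hg using fun u : R => hout u.1 u.2
  let G : R → R := fun u => ⟨g u, hgR u⟩
  have hG : ∀ u : R, D.Adj u (G u) := hg
  obtain ⟨a, ha⟩ := hR
  obtain ⟨i, j, hij, heq⟩ :=
    Finite.exists_ne_map_eq_of_infinite fun k : ℕ => G^[k] (⟨a, ha⟩ : R)
  obtain ⟨b, n, hn, hb⟩ : ∃ b : R, ∃ n, 0 < n ∧ Function.IsPeriodicPt G n b := by
    rcases lt_or_gt_of_ne hij with h | h
    · refine ⟨G^[i] ⟨a, ha⟩, j - i, by lia, ?_⟩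
      rw [Function.IsPeriodicPt, Function.IsFixedPt, ← Function.iterate_add_apply,
        Nat.sub_add_cancel h.le]
      exact heq.symm
    · refine ⟨G^[j] ⟨a, ha⟩, i - j, by lia, ?_⟩
      rw [Function.IsPeriodicPt, Function.IsFixedPt, ← Function.iterate_add_apply,
        Nat.sub_add_cancel h.le]
      exact heq
  have hstep : ∀ k, D.Adj (G^[k] b : V) (G^[k + 1] b : V) := fun k => by
    rw [Function.iterate_succ_apply']
    exact hG _
  refine ⟨Set.range fun k => (G^[k] b : V), ⟨_, ⟨0, rfl⟩, _, ⟨1, rfl⟩, fun h => ?_⟩, ?_⟩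
  · have := hstep 0
    simp only [Function.iterate_zero, Function.iterate_one, id] at h this
    exact hloop _ (h ▸ this)
  · rintro _ ⟨k, rfl⟩ _ ⟨l, rfl⟩
    have hwalk : ∀ m, Relation.ReflTransGen (fun a c => a ∈ Set.range (fun k => (G^[k] b : V)) ∧
        c ∈ Set.range (fun k => (G^[k] b : V)) ∧ D.Adj a c) (G^[k] b : V) (G^[k + m] b : V) := by
      intro m
      induction m with
      | zero => exact Relation.ReflTransGen.refl
      | succ m ih => exact ih.tail ⟨⟨k + m, rfl⟩, ⟨k + m + 1, rfl⟩, hstep (k + m)⟩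
    -- Adding `k` full periods makes the target index at least `k`, so a forward walk reaches it.
    have hl : G^[l + k * n] b = G^[l] b := by
      rw [Function.iterate_add_apply, (hb.const_mul k).eq]
    have hk : k ≤ l + k * n := (Nat.le_mul_of_pos_right k hn).trans (Nat.le_add_left _ _)
    have := hwalk (l + k * n - k)
    rw [Nat.add_sub_cancel' hk, hl] at this
    exact this

/-! ### Solving the linear system, and the equivalence. -/

namespace SMP

variable {F W : Type*} {I : SMP F W} {v : F ⊕ W}

open Classical in
-- From a regular vertex, walk along a uniformly chosen edge of its out-set. For a stationary `p`,
-- the variable at `u` is the flow `p u / |outSet u|` per edge: stationarity gives `lp1` and `lp2`,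
-- and total mass `1` gives `lp3`.
theorem exists_isLPSolution [Fintype F] [Fintype W] {x : I.E → ℝ} (hx : I.Stable x)
    (hne : ∃ v, I.Regular x v) : ∃ φ ψ, I.IsLPSolution x 1 φ ψ := by
  let s : Finset (F ⊕ W) := Finset.univ.filter fun v => I.Regular x v
  have hms : ∀ v, v ∈ s ↔ I.Regular x v := fun v => by simp [s]
  let P : F ⊕ W → F ⊕ W → ℝ := fun u v =>
    ∑ e ∈ I.outSet x u, if I.otherEnd u e = v then ((I.outSet x u).card : ℝ)⁻¹ else 0
  have hcard : ∀ u, I.Regular x u → ((I.outSet x u).card : ℝ) ≠ 0 := fun u hu =>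
    Nat.cast_ne_zero.2 (Finset.card_ne_zero.2 (hu.outSet_nonempty hx))
  obtain ⟨p, hp0, hp1, hpP⟩ := s.exists_stationary
    (hne.imp fun v hv => (hms v).2 hv) P
    (fun u v => Finset.sum_nonneg fun e _ => by split_ifs <;> positivity) (fun u hu => by
      rw [hms] at hu
      rw [Finset.sum_comm, Finset.sum_congr rfl (g := fun _ => ((I.outSet x u).card : ℝ)⁻¹)
        fun e he => ?_, Finset.sum_const, nsmul_eq_mul, mul_inv_cancel₀ (hcard u hu)]
      rw [Finset.sum_ite_eq, if_pos ((hms _).2 (ActiveAt.regular_otherEnd hx ⟨hu, he⟩))])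
  let val : F ⊕ W → ℝ := fun u => p u / (I.outSet x u).card
  have hval : ∀ u, I.Regular x u → ((I.outSet x u).card : ℝ) * val u = p u := fun u hu =>
    mul_div_cancel₀ _ (hcard u hu)
  have hbal : ∀ v, I.Regular x v → p v =
      ∑ e, ∑ u, if I.ActiveAt x u e ∧ I.otherEnd u e = v then val u else 0 := by
    intro v hv
    rw [← hpP v ((hms v).2 hv), Finset.sum_comm, Finset.sum_filter]
    refine Finset.sum_congr rfl fun u _ => ?_
    by_cases hu : I.Regular x u
    · simp only [hu, if_true, P, ActiveAt, true_and, Finset.mul_sum, ite_and]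
      rw [← Finset.sum_filter, Finset.filter_univ_mem]
      exact Finset.sum_congr rfl fun e _ => by split_ifs <;> simp [val, div_eq_mul_inv]
    · simp [hu, ActiveAt]
  have hactive : ∀ u e, I.ActiveAt x u e → e ∈ I.star u := fun u e h => outSet_subset_star hx h.2
  refine ⟨fun f => val (Sum.inl f), fun w => val (Sum.inr w), fun f hf => ?_, fun w hw => ?_, ?_,
    fun f _ => div_nonneg (hp0 _) (Nat.cast_nonneg _),
    fun w _ => div_nonneg (hp0 _) (Nat.cast_nonneg _)⟩
  · have h := hval _ hf
    rw [hbal _ hf] at h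
    rw [sub_eq_zero]
    refine h.trans ?_
    rw [Finset.sum_filter, ← Finset.sum_subset (Finset.subset_univ (I.star (Sum.inl f)))]
    · refine Finset.sum_congr rfl fun e he => ?_
      -- Flow enters a firm along `e` only from the worker at `e`.
      rw [Finset.sum_eq_single (I.worker e)]
      · have : I.otherEnd (I.worker e) e = Sum.inl f := by
          rw [mem_star_inl.1 he]; rfl
        simp only [this, and_true]
        rfl
      · rintro (f' | w) - hne
        · simp [otherEnd, worker]
        · rw [if_neg]
          rintro ⟨h, -⟩
          exact hne (by rw [worker, mem_star_inr.1 (hactive _ _ h)])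
      · simp
    · intro e _ he
      refine Finset.sum_eq_zero fun u _ => if_neg ?_
      rintro ⟨-, h⟩
      rw [mem_star, ← h] at he
      exact he (isEnd_otherEnd e)
  · have h := hval _ hw
    rw [hbal _ hw] at h
    rw [sub_eq_zero]
    refine h.trans ?_
    rw [Finset.sum_filter, ← Finset.sum_subset (Finset.subset_univ (I.star (Sum.inr w)))]
    · refine Finset.sum_congr rfl fun e he => ?_
      rw [Finset.sum_eq_single (I.firm e)]
      · have : I.otherEnd (I.firm e) e = Sum.inr w := by
          rw [mem_star_inr.1 he]; rfl
        simp only [this, and_true]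
        rfl
      · rintro (f | w') - hne
        · rw [if_neg]
          rintro ⟨h, -⟩
          exact hne (by rw [firm, mem_star_inl.1 (hactive _ _ h)])
        · simp [otherEnd, firm]
      · simp
    · intro e _ he
      refine Finset.sum_eq_zero fun u _ => if_neg ?_
      rintro ⟨-, h⟩
      rw [mem_star, ← h] at he
      exact he (isEnd_otherEnd e)
  · rw [← hp1, Finset.sum_filter (s := Finset.univ) (fun v => I.Regular x v) p,
      Fintype.sum_sum_type, ← Finset.sum_filter, ← Finset.sum_filter]
    congr 1
    · exact Finset.sum_congr rfl fun f hf => hval _ (Finset.mem_filter.1 hf).2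
    · exact Finset.sum_congr rfl fun f hf => hval _ (Finset.mem_filter.1 hf).2

theorem exists_isStrongComponent_iff [Finite F] [Finite W] {x : I.E → ℝ} (hx : I.Stable x) :
    (∃ L, (I.activeGraph x).IsStrongComponent L) ↔ ∃ v, I.Regular x v := by
  constructor
  · rintro ⟨L, ⟨⟨u, hu, v, hv, huv⟩, hL⟩, -⟩
    rcases (hL u hu v hv).cases_head with h | ⟨c, ⟨-, -, -, e, he, -⟩, -⟩
    · exact absurd h huv
    · exact ⟨u, he.1⟩
  · intro h
    refine Digraph.exists_isStrongComponent _ (R := {v | I.Regular x v}) h (fun u hu => ?_)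
      fun u h => h.1 rfl
    obtain ⟨e, he⟩ := Regular.outSet_nonempty hx hu
    have hact : I.ActiveAt x u e := ⟨hu, he⟩
    exact ⟨_, hact.regular_otherEnd hx, otherEnd_ne e, e, hact, isEnd_otherEnd e⟩

end SMP

theorem mainTheorem9 {F W : Type*} [Fintype F] [Fintype W] (I : SMP F W)
    (x : I.E → ℝ) (hx : I.Stable x) :
    List.TFAE [
      ¬ I.IsXMax x,
      ∃ ε : ℝ, 0 < ε ∧ ∃ (φ : F → ℝ) (ψ : W → ℝ), I.IsLPSolution x ε φ ψ,
      (I.activeEdges x).Nonempty,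
      ∃ L : Set (F ⊕ W), (I.activeGraph x).IsStrongComponent L] := by
  rw [SMP.activeEdges_nonempty_iff hx, SMP.exists_isStrongComponent_iff hx]
  tfae_have 1 → 3 := fun h => by
    obtain ⟨z, hz, hne, hpref⟩ := SMP.exists_stable_preferred hx h
    exact SMP.exists_regular_of_preferred hx hz hne hpref
  tfae_have 3 → 2 := fun h => ⟨1, one_pos, SMP.exists_isLPSolution hx h⟩
  tfae_have 2 → 1 := fun ⟨_, hε, _, _, hlp⟩ => SMP.not_isXMax_of_isLPSolution hx hlp hε
  tfae_have 3 ↔ 4 := Iff.rfl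
  tfae_finish
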